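/- Let $\mathbb O$ be the octonions with their standard inner product $x\cdot y$, norm $|x|$ and conjugation $C(x)=\bar x$, and let $L_x,R_x$ be left and right multiplication by $x\in\mathbb O$. For $(r,x)\in\mathbb R\oplus\mathbb O$ let $$m_{(r,x)}= i\begin{pmatrix} r\,I_8 & C R_x\\ C L_x & -r\,I_8\end{pmatrix}$$ acting on $\mathbb C\otimes\mathbb O^2$, and let $\mathrm{Spin}(9)\subset \mathrm{GL}_{\mathbb R}(\mathbb O^2)$ be the group generated by the (real) products $m_{(r,x)}m_{(s,y)}$ with $r^2+|x|^2=s^2+|y|^2=1$. Let $H\subset \mathrm{SO}(8)^3$ be the group of triples $(g_1,g_2,g_3)$ of elements of $\mathrm{SO}(\mathbb O)$ with $g_2(xy)=g_1(x)\,g_3(y)$ for all $x,y\in\mathbb O$, and let $K_1\subset\mathrm{GL}_{\mathbb R}(\mathbb O^2)$ be the group of the operators $(x,y)\mapsto(g_1(x),g_3(y))$ with $(g_1,g_2,g_3)\in H$ and $g_1(1)=1$. Put $q(x,y)=|x|^2+|y|^2$ on $\mathbb O^2$ and, for $(v_1,v_2)=((x_1,y_1),(x_2,y_2))\in\mathbb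 O^2\oplus\mathbb O^2$, $$q_{2,0}=|x_1|^2+|y_1|^2,\qquad q_{1,1}=x_1\cdot x_2+y_1\cdot y_2,\qquad q_{0,2}=|x_2|^2+|y_2|^2,$$ $$q_{2,2}=(|x_1|^2-|y_1|^2)(|x_2|^2-|y_2|^2)+4\,(x_1y_1)\cdot(x_2y_2).$$ Then: 1. $\mathrm{Spin}(9)\subset\mathrm{SO}(\mathbb O^2)=\mathrm{SO}(16)$, and $\mathrm{Spin}(9)$ acts transitively on the unit sphere $S^{15}\subset\mathbb O^2$. 2. The algebra of $\mathrm{Spin}(9)$-invariant real polynomials on $\mathbb O^2$ is generated by $q$. 3. The stabilizer of $(1,0)\in\mathbb O^2$ in $\mathrm{Spin}(9)$ is $K_1$, and $K_1$ is isomorphic, as a topological group (hence as a Lie group), to $\mathrm{Spin}(7)$. 4. For the diagonal action of $\mathrm{Spin}(9)$ on $\mathbb O^2\oplus\mathbb O^2$, the generic orbit has codimension $4$: there is a nonzero polynomial $P$ on $\mathbb O^2\oplus\mathbb O^2$ such that the orbit of every $z$ with $P(z)\neq0$ is a smooth embedded submanifold of codimension $4$. 5. The $\mathrm{Spin}(9)$-orbits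 on $\mathbb O^2\oplus\mathbb O^2$ are exactly the (nonempty) simultaneous level sets of $q_{2,0}$, $q_{1,1}$, $q_{0,2}$ and $q_{2,2}$. -/

import Mathlib

open scoped TensorProduct ContDiff

noncomputable section

namespace SpinNine

/-! ### The octonions -/

/-- The octonions as pairs of quaternions (Cayley–Dickson), with the Euclidean inner product. -/
def Oct : Type := WithLp 2 (Quaternion ℝ × Quaternion ℝ)

instance : NormedAddCommGroup Oct :=
  inferInstanceAs (NormedAddCommGroup (WithLp 2 (Quaternion ℝ × Quaternion ℝ)))

instance : InnerProductSpace ℝ Oct :=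
  inferInstanceAs (InnerProductSpace ℝ (WithLp 2 (Quaternion ℝ × Quaternion ℝ)))

namespace Oct

def mk (a b : Quaternion ℝ) : Oct := WithLp.toLp 2 (a, b)

def fst (x : Oct) : Quaternion ℝ := WithLp.fst x

def snd (x : Oct) : Quaternion ℝ := WithLp.snd x

instance : One Oct := ⟨mk 1 0⟩

/-- Octonion multiplication `(a, b) (c, d) = (a c - d̄ b, d a + b c̄)`. -/
instance : Mul Oct :=
  ⟨fun x y => mk (x.fst * y.fst - star y.snd * x.snd) (y.snd * x.fst + x.snd * star y.fst)⟩

@[ext] theorem ext {x y : Oct} (h : x.fst = y.fst) (h' : x.snd = y.snd) : x = y :=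
  WithLp.ofLp_injective 2 (Prod.ext h h')

@[simp] theorem add_fst (x y : Oct) : (x + y).fst = x.fst + y.fst := rfl
@[simp] theorem add_snd (x y : Oct) : (x + y).snd = x.snd + y.snd := rfl
@[simp] theorem smul_fst (r : ℝ) (x : Oct) : (r • x).fst = r • x.fst := rfl
@[simp] theorem smul_snd (r : ℝ) (x : Oct) : (r • x).snd = r • x.snd := rfl
@[simp] theorem mul_fst (x y : Oct) :
    (x * y).fst = x.fst * y.fst - star y.snd * x.snd := rfl
@[simp] theorem mul_snd (x y : Oct) :
    (x * y).snd = y.snd * x.fst + x.snd * star y.fst := rfl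

end Oct

/-- Left multiplication `L_x`. -/
def L (x : Oct) : Oct →ₗ[ℝ] Oct where
  toFun y := x * y
  map_add' y z := by
    ext1 <;> simp only [Oct.mul_fst, Oct.mul_snd, Oct.add_fst, Oct.add_snd, star_add, mul_add,
      add_mul] <;> abel
  map_smul' r y := by ext1 <;> simp [smul_sub, smul_add]

/-- Right multiplication `R_x`. -/
def R (x : Oct) : Oct →ₗ[ℝ] Oct where
  toFun y := y * x
  map_add' y z := by
    ext1 <;> simp only [Oct.mul_fst, Oct.mul_snd, Oct.add_fst, Oct.add_snd, mul_add,
      add_mul] <;> abel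
  map_smul' r y := by ext1 <;> simp [smul_sub, smul_add]

/-- Octonion conjugation `C x = 2 ⟨x, 1⟩ 1 - x`. -/
def C : Oct →ₗ[ℝ] Oct where
  toFun x := (2 * inner ℝ x 1 : ℝ) • (1 : Oct) - x
  map_add' x y := by rw [inner_add_left, mul_add, add_smul]; abel
  map_smul' r x := by
    rw [real_inner_smul_left, RingHom.id_apply, smul_sub, smul_smul]; congr 2; ring

/-! ### The group `Spin(9)` acting on `O²` -/

/-- The space `O²` with its Euclidean structure. -/
def Oct2 : Type := WithLp 2 (Oct × Oct)

instance : NormedAddCommGroup Oct2 :=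
  inferInstanceAs (NormedAddCommGroup (WithLp 2 (Oct × Oct)))

instance : InnerProductSpace ℝ Oct2 :=
  inferInstanceAs (InnerProductSpace ℝ (WithLp 2 (Oct × Oct)))

namespace Oct2

def mk (x y : Oct) : Oct2 := WithLp.toLp 2 (x, y)

def fst (v : Oct2) : Oct := WithLp.fst v

def snd (v : Oct2) : Oct := WithLp.snd v

@[ext] theorem ext {v w : Oct2} (h : v.fst = w.fst) (h' : v.snd = w.snd) : v = w :=
  WithLp.ofLp_injective 2 (Prod.ext h h')

@[simp] theorem mk_fst (x y : Oct) : (mk x y).fst = x := rfl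
@[simp] theorem mk_snd (x y : Oct) : (mk x y).snd = y := rfl
@[simp] theorem add_fst (v w : Oct2) : (v + w).fst = v.fst + w.fst := rfl
@[simp] theorem add_snd (v w : Oct2) : (v + w).snd = v.snd + w.snd := rfl
@[simp] theorem smul_fst (r : ℝ) (v : Oct2) : (r • v).fst = r • v.fst := rfl
@[simp] theorem smul_snd (r : ℝ) (v : Oct2) : (r • v).snd = r • v.snd := rfl

end Oct2

/-- `GL_ℝ(O²)`, with its usual topology. -/
abbrev GLOct2 : Type := (Oct2 →L[ℝ] Oct2)ˣ

/-- The real block matrix `[[r, C R_x], [C L_x, -r]]`. -/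
def blockMap (r : ℝ) (x : Oct) : Oct2 →ₗ[ℝ] Oct2 where
  toFun v := Oct2.mk (r • v.fst + C (R x v.snd)) (C (L x v.fst) - r • v.snd)
  map_add' v w := by
    apply Oct2.ext <;> simp only [Oct2.mk_fst, Oct2.mk_snd, Oct2.add_fst, Oct2.add_snd, map_add,
      smul_add] <;> abel
  map_smul' c v := by
    apply Oct2.ext <;> simp only [Oct2.mk_fst, Oct2.mk_snd, Oct2.smul_fst, Oct2.smul_snd,
      map_smul, smul_add, smul_sub, RingHom.id_apply, smul_comm r c]

/-- Clifford multiplication by `(r, x) ∈ ℝ ⊕ O` on `ℂ ⊗ O²`: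
`m_(r,x) = i [[r, C R_x], [C L_x, -r]]`. -/
def m (r : ℝ) (x : Oct) : ℂ ⊗[ℝ] Oct2 →ₗ[ℂ] ℂ ⊗[ℝ] Oct2 :=
  Complex.I • (blockMap r x).baseChange ℂ

/-- `Spin(9)`: the group generated by the products `m_(r,x) m_(s,y)` of two unit vectors of
`ℝ ⊕ O`. These products are complexifications of real operators, so that the group is a subgroup
of `GL_ℝ(O²)`. -/
def Spin9 : Subgroup GLOct2 :=
  Subgroup.closure {g | ∃ (r : ℝ) (x : Oct) (s : ℝ) (y : Oct),
    r ^ 2 + ‖x‖ ^ 2 = 1 ∧ s ^ 2 + ‖y‖ ^ 2 = 1 ∧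
    ((g : Oct2 →L[ℝ] Oct2) : Oct2 →ₗ[ℝ] Oct2).baseChange ℂ = m r x ∘ₗ m s y}

/-- `SO(O²) = SO(16)`. -/
def SO16 : Subgroup GLOct2 where
  carrier := {g | (∀ v : Oct2, ‖(g : Oct2 →L[ℝ] Oct2) v‖ = ‖v‖) ∧
    LinearMap.det ((g : Oct2 →L[ℝ] Oct2) : Oct2 →ₗ[ℝ] Oct2) = 1}
  one_mem' := ⟨fun _ => rfl, LinearMap.det_id⟩
  mul_mem' := by
    rintro a b ⟨ha, ha'⟩ ⟨hb, hb'⟩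
    refine ⟨fun v => (ha _).trans (hb v), ?_⟩
    have := LinearMap.det_comp ((a : Oct2 →L[ℝ] Oct2) : Oct2 →ₗ[ℝ] Oct2)
      ((b : Oct2 →L[ℝ] Oct2) : Oct2 →ₗ[ℝ] Oct2)
    rw [ha', hb', one_mul] at this
    exact this
  inv_mem' := by
    rintro a ⟨ha, ha'⟩
    have key : ∀ v, (a : Oct2 →L[ℝ] Oct2) ((a⁻¹ : GLOct2).val v) = v := fun v =>
      congrArg (fun f : Oct2 →L[ℝ] Oct2 => f v) a.mul_inv
    refine ⟨fun v => by rw [← ha, key], ?_⟩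
    have := LinearMap.det_comp ((a : Oct2 →L[ℝ] Oct2) : Oct2 →ₗ[ℝ] Oct2)
      (((a⁻¹ : GLOct2) : Oct2 →L[ℝ] Oct2) : Oct2 →ₗ[ℝ] Oct2)
    rw [ha', one_mul] at this
    rw [← this, show ((a : Oct2 →L[ℝ] Oct2) : Oct2 →ₗ[ℝ] Oct2) ∘ₗ
      (((a⁻¹ : GLOct2) : Oct2 →L[ℝ] Oct2) : Oct2 →ₗ[ℝ] Oct2) = LinearMap.id from
        LinearMap.ext key, LinearMap.det_id]

/-! ### The group `K₁` -/

/-- `g` lies in `SO(O) = SO(8)`. -/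
def IsSO8 (g : Oct ≃ₗᵢ[ℝ] Oct) : Prop :=
  LinearMap.det (g.toLinearEquiv : Oct →ₗ[ℝ] Oct) = 1

/-- The group `H` of triples `(g₁, g₂, g₃) ∈ SO(8)³` with `g₂ (x y) = g₁ x · g₃ y`. -/
def H : Subgroup ((Oct ≃ₗᵢ[ℝ] Oct) × (Oct ≃ₗᵢ[ℝ] Oct) × (Oct ≃ₗᵢ[ℝ] Oct)) where
  carrier := {g | IsSO8 g.1 ∧ IsSO8 g.2.1 ∧ IsSO8 g.2.2 ∧
    ∀ x y : Oct, g.2.1 (x * y) = g.1 x * g.2.2 y}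
  one_mem' := ⟨LinearMap.det_id, LinearMap.det_id, LinearMap.det_id, fun _ _ => rfl⟩
  mul_mem' := by
    have key : ∀ a b : Oct ≃ₗᵢ[ℝ] Oct, IsSO8 a → IsSO8 b → IsSO8 (a * b) := by
      intro a b ha hb
      have := LinearMap.det_comp (a.toLinearEquiv : Oct →ₗ[ℝ] Oct)
        (b.toLinearEquiv : Oct →ₗ[ℝ] Oct)
      rw [show LinearMap.det (a.toLinearEquiv : Oct →ₗ[ℝ] Oct) = 1 from ha,
        show LinearMap.det (b.toLinearEquiv : Oct →ₗ[ℝ] Oct) = 1 from hb, one_mul] at this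
      exact this
    rintro a b ⟨ha1, ha2, ha3, ha⟩ ⟨hb1, hb2, hb3, hb⟩
    refine ⟨key _ _ ha1 hb1, key _ _ ha2 hb2, key _ _ ha3 hb3, fun x y => ?_⟩
    change a.2.1 (b.2.1 (x * y)) = a.1 (b.1 x) * a.2.2 (b.2.2 y)
    rw [hb, ha]
  inv_mem' := by
    have key : ∀ a : Oct ≃ₗᵢ[ℝ] Oct, IsSO8 a → IsSO8 a⁻¹ := by
      intro a ha
      have := LinearMap.det_comp (a.toLinearEquiv : Oct →ₗ[ℝ] Oct)
        ((a⁻¹).toLinearEquiv : Oct →ₗ[ℝ] Oct)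
      rw [show LinearMap.det (a.toLinearEquiv : Oct →ₗ[ℝ] Oct) = 1 from ha, one_mul,
        show (a.toLinearEquiv : Oct →ₗ[ℝ] Oct) ∘ₗ ((a⁻¹).toLinearEquiv : Oct →ₗ[ℝ] Oct)
          = LinearMap.id from LinearMap.ext a.apply_symm_apply, LinearMap.det_id] at this
      exact this.symm
    rintro a ⟨ha1, ha2, ha3, ha⟩
    refine ⟨key _ ha1, key _ ha2, key _ ha3, fun x y => ?_⟩
    change a.2.1.symm (x * y) = a.1.symm x * a.2.2.symm y
    rw [LinearIsometryEquiv.symm_apply_eq, ha]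
    simp only [LinearIsometryEquiv.apply_symm_apply]

/-- `K₁`: the triples of `H` with `g₁ 1 = 1`, regarded as the operators
`(x, y) ↦ (g₁ x, g₃ y)` of `O²`. -/
def K1 : Subgroup GLOct2 where
  carrier := {g | ∃ h ∈ H, h.1 1 = 1 ∧
    ∀ v : Oct2, (g : Oct2 →L[ℝ] Oct2) v = Oct2.mk (h.1 v.fst) (h.2.2 v.snd)}
  one_mem' := ⟨1, one_mem _, rfl, fun _ => rfl⟩
  mul_mem' := by
    rintro a b ⟨h, hh, h1, ha⟩ ⟨k, hk, k1, hb⟩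
    refine ⟨h * k, mul_mem hh hk, ?_, fun v => ?_⟩
    · change h.1 (k.1 1) = 1
      rw [k1, h1]
    · change (a : Oct2 →L[ℝ] Oct2) ((b : Oct2 →L[ℝ] Oct2) v) = _
      rw [hb, ha]
      rfl
  inv_mem' := by
    rintro a ⟨h, hh, h1, ha⟩
    refine ⟨h⁻¹, inv_mem hh, ?_, fun v => ?_⟩
    · change h.1.symm 1 = 1
      rw [LinearIsometryEquiv.symm_apply_eq, h1]
    · have hv : v = (a : Oct2 →L[ℝ] Oct2)
          (Oct2.mk (h.1.symm v.fst) (h.2.2.symm v.snd)) := by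
        rw [ha]
        exact Oct2.ext (h.1.apply_symm_apply v.fst).symm (h.2.2.apply_symm_apply v.snd).symm
      have key : ∀ w, (a⁻¹ : GLOct2).val ((a : Oct2 →L[ℝ] Oct2) w) = w := fun w =>
        congrArg (fun f : Oct2 →L[ℝ] Oct2 => f w) a.inv_mul
      conv_lhs => rw [hv]
      rw [key]
      rfl

/-! ### The abstract group `Spin(7)` -/

/-- The quadratic form `-|x|²` on `ℝ⁷`, so that `v² = -|v|²` in its Clifford algebra. -/
def Q7 : QuadraticForm ℝ (EuclideanSpace ℝ (Fin 7)) :=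
  -LinearMap.BilinMap.toQuadraticMap (innerₗ (EuclideanSpace ℝ (Fin 7)))

/-- The usual topology of the finite-dimensional real vector space `Cℓ(ℝ⁷)`. -/
instance : TopologicalSpace (CliffordAlgebra Q7) := moduleTopology ℝ _

/-- `Spin(7)`, with the topology of a subset of the Clifford algebra. -/
abbrev Spin7 : Submonoid (CliffordAlgebra Q7) := spinGroup Q7

/-! ### Invariant polynomials and submanifolds -/

/-- The algebra of real polynomial functions on a real vector space: the one generated by the
linear functionals. -/
def polyFun (V : Type) [AddCommGroup V] [Module ℝ V] : Subalgebra ℝ (V → ℝ) :=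
  Algebra.adjoin ℝ (Set.range fun l : V →ₗ[ℝ] ℝ => (l : V → ℝ))

/-- The `Spin(9)`-invariant polynomial functions on `O²`. -/
def invPoly : Subalgebra ℝ (Oct2 → ℝ) where
  carrier := {f | f ∈ polyFun Oct2 ∧ ∀ (g : Spin9) (v : Oct2), f (g • v) = f v}
  mul_mem' := fun ha hb => ⟨mul_mem ha.1 hb.1, fun g v => by
    simp only [Pi.mul_apply, ha.2 g v, hb.2 g v]⟩
  add_mem' := fun ha hb => ⟨add_mem ha.1 hb.1, fun g v => by
    simp only [Pi.add_apply, ha.2 g v, hb.2 g v]⟩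
  algebraMap_mem' := fun r => ⟨Subalgebra.algebraMap_mem _ r, fun _ _ => rfl⟩

/-- `S` is a smooth embedded submanifold of codimension `k` of the normed space `E`: near each of
its points it is the zero set of a smooth submersion to `ℝᵏ`. -/
def IsSubmanifoldOfCodim {E : Type} [NormedAddCommGroup E] [NormedSpace ℝ E] (k : ℕ)
    (S : Set E) : Prop :=
  ∀ p ∈ S, ∃ (U : Set E) (f : E → EuclideanSpace ℝ (Fin k)), IsOpen U ∧ p ∈ U ∧
    ContDiffOn ℝ ∞ f U ∧ (∀ x ∈ U, Function.Surjective (fderiv ℝ f x)) ∧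
    S ∩ U = {x ∈ U | f x = 0}

/-! ### The polynomials -/

/-- `q (x, y) = |x|² + |y|²`. -/
def q (v : Oct2) : ℝ := ‖v.fst‖ ^ 2 + ‖v.snd‖ ^ 2

/-- The squaring map `σ (x, y) = (|x|² - |y|², 2 x y)` to `ℝ ⊕ O`. -/
def σ (v : Oct2) : WithLp 2 (ℝ × Oct) :=
  WithLp.toLp 2 (‖v.fst‖ ^ 2 - ‖v.snd‖ ^ 2, (2 : ℝ) • (v.fst * v.snd))

def q20 (z : Oct2 × Oct2) : ℝ := ‖z.1.fst‖ ^ 2 + ‖z.1.snd‖ ^ 2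

def q11 (z : Oct2 × Oct2) : ℝ := inner ℝ z.1.fst z.2.fst + inner ℝ z.1.snd z.2.snd

def q02 (z : Oct2 × Oct2) : ℝ := ‖z.2.fst‖ ^ 2 + ‖z.2.snd‖ ^ 2

def q22 (z : Oct2 × Oct2) : ℝ := inner ℝ (σ z.1) (σ z.2)

end SpinNine

end

open scoped TensorProduct ContDiff

noncomputable section

namespace SpinNine

open scoped Quaternion

/-! ### Octonion arithmetic -/

namespace Oct

/-! Up to sign, the generators of Spin(9) are products of two real symmetric operators `T u` on O²
with the Clifford relation T u T w + T w T u = 2⟨u, w⟩. The squaring map `σ` is dual to them, ⟨T w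
v, v⟩ = ⟨w, σ v⟩, so for unit w the operator `T w` covers a half-turn of ℝ ⊕ O (`σ_T`). Hence each
element of Spin(9) is orthogonal on O² and acts through `σ` by an isometry of ℝ ⊕ O. This makes
|v₁|², v₁·v₂, |v₂|² and q₂₂ = σ(v₁)·σ(v₂) invariant.

Conversely, explicit operators `T w` bring any v to (|v|, 0) (`exists_smul_eq_mk`). This gives
transitivity on spheres, and an invariant polynomial becomes an even polynomial in |v|. An element
fixing (1, 0) preserves the first coordinate of `σ`, so it is block diagonal, and equivariance of
the second coordinate reads g₃(ab) = g₁(a)g₃(b). In the other direction, an element of K₁ and a lift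
to Spin(9) of the rotation g₃ have the same effect on `σ`, so they differ by ±1
(`eq_one_or_eq_neg_one`).

For pairs, take v₁ = (t, 0) with t ≠ 0. The group K₁ still acts on v₂ = (x, y), and Re x, |x|, |y|
separate its orbits (`exists_K1`); the four polynomials determine exactly these numbers. Generic
orbits are regular fibres of the map `quad` to ℝ⁴, whose rank is computed at the normal form.

The link with Spin(7) is u(ab) = (uau⁻¹)(ub) for imaginary units u (`LU_mul`). Cartan–Dieudonné in
the imaginary octonions, together with the triviality of the nuclei of O, shows that every g₃
occurring in K₁ is a product of exactly eight left multiplications by imaginary units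
(`exists_list_of_related`). The Clifford algebra of ℝ⁷ acts on O by such multiplications,
injectively on Spin(7). So Spin(7) is the set of products of eight unit vectors, it is compact, and
its continuous bijection onto K₁ is a homeomorphism. -/

@[simp] theorem mk_fst (a b : Quaternion ℝ) : (mk a b).fst = a := rfl
@[simp] theorem mk_snd (a b : Quaternion ℝ) : (mk a b).snd = b := rfl
@[simp] theorem one_fst : (1 : Oct).fst = 1 := rfl
@[simp] theorem one_snd : (1 : Oct).snd = 0 := rfl
@[simp] theorem zero_fst : (0 : Oct).fst = 0 := rfl
@[simp] theorem zero_snd : (0 : Oct).snd = 0 := rfl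
@[simp] theorem neg_fst (x : Oct) : (-x).fst = -x.fst := rfl
@[simp] theorem neg_snd (x : Oct) : (-x).snd = -x.snd := rfl
@[simp] theorem sub_fst (x y : Oct) : (x - y).fst = x.fst - y.fst := rfl
@[simp] theorem sub_snd (x y : Oct) : (x - y).snd = x.snd - y.snd := rfl

theorem inner_eq (x y : Oct) :
    inner ℝ x y = x.fst.re * y.fst.re + x.fst.imI * y.fst.imI + x.fst.imJ * y.fst.imJ
      + x.fst.imK * y.fst.imK + (x.snd.re * y.snd.re + x.snd.imI * y.snd.imI
      + x.snd.imJ * y.snd.imJ + x.snd.imK * y.snd.imK) := by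
  have : inner ℝ x y = inner ℝ x.fst y.fst + inner ℝ x.snd y.snd :=
    WithLp.prod_inner_apply (𝕜 := ℝ) (E := Quaternion ℝ) (F := Quaternion ℝ) x y
  rw [this, Quaternion.inner_def, Quaternion.inner_def]
  simp only [Quaternion.re_mul, Quaternion.re_star, Quaternion.imI_star, Quaternion.imJ_star,
    Quaternion.imK_star]
  ring

scoped instance : MulOneClass Oct where
  one_mul x := by ext1 <;> simp
  mul_one x := by ext1 <;> simp

scoped instance : NonUnitalNonAssocRing Oct where
  left_distrib x y z := (L x).map_add y z
  right_distrib x y z := (R z).map_add x y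
  zero_mul x := (R x).map_zero
  mul_zero x := (L x).map_zero

scoped instance : IsScalarTower ℝ Oct Oct := ⟨fun r x y => (R y).map_smul r x⟩
scoped instance : SMulCommClass ℝ Oct Oct := ⟨fun r x y => ((L x).map_smul r y).symm⟩

end Oct

/-! ### Conjugation and the composition identities -/

open Oct

@[simp] theorem L_apply (x y : Oct) : L x y = x * y := rfl
@[simp] theorem R_apply (x y : Oct) : R x y = y * x := rfl

theorem C_apply (x : Oct) : C x = (2 * inner ℝ x 1 : ℝ) • (1 : Oct) - x := rfl

theorem C_eq_mk (x : Oct) : C x = Oct.mk (star x.fst) (-x.snd) := by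
  rw [C_apply, Oct.inner_eq]
  ext <;> simp; ring

@[simp] theorem C_fst (x : Oct) : (C x).fst = star x.fst := by rw [C_eq_mk]; rfl
@[simp] theorem C_snd (x : Oct) : (C x).snd = -x.snd := by rw [C_eq_mk]; rfl

@[simp] theorem C_C (x : Oct) : C (C x) = x := by ext1 <;> simp
@[simp] theorem C_one : C 1 = 1 := by ext1 <;> simp

theorem C_mul (x y : Oct) : C (x * y) = C y * C x := by
  ext1 <;> simp

theorem inner_C_C (x y : Oct) : inner ℝ (C x) (C y) = inner ℝ x y := by
  simp [Oct.inner_eq]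

theorem inner_C_left (x y : Oct) : inner ℝ (C x) y = inner ℝ x (C y) := by
  rw [← inner_C_C, C_C]

@[simp] theorem norm_C (x : Oct) : ‖C x‖ = ‖x‖ := by
  rw [norm_eq_sqrt_real_inner, norm_eq_sqrt_real_inner, inner_C_C]

theorem inner_mul_left_C (x y z : Oct) : inner ℝ (x * y) z = inner ℝ y (C x * z) := by
  simp [Oct.inner_eq]
  ring

theorem inner_mul_right_C (x y z : Oct) : inner ℝ (x * y) z = inner ℝ x (z * C y) := by
  simp [Oct.inner_eq]
  ring

/-- The form of alternativity on which everything rests: it is checked in quaternion coordinates,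
and the remaining identities follow by conjugation, adjunction and polarization. -/
theorem C_mul_mul (x y : Oct) : C x * (x * y) = (inner ℝ x x : ℝ) • y := by
  rw [Oct.inner_eq]
  ext <;> simp <;> ring

theorem inner_self_eq (x : Oct) : (inner ℝ x x : ℝ) = ‖x‖ ^ 2 := real_inner_self_eq_norm_sq x

theorem mul_C_mul (x y : Oct) : x * (C x * y) = (inner ℝ x x : ℝ) • y := by
  simpa [inner_C_C] using C_mul_mul (C x) y

theorem mul_mul_C (x y : Oct) : (y * x) * C x = (inner ℝ x x : ℝ) • y := by
  have h := congrArg C (mul_C_mul x (C y))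
  rwa [C_mul, C_mul, C_C, C_C, map_smul, C_C] at h

theorem mul_C_self (x : Oct) : x * C x = (inner ℝ x x : ℝ) • 1 := by
  simpa using mul_mul_C x 1

theorem C_mul_self (x : Oct) : C x * x = (inner ℝ x x : ℝ) • 1 := by
  simpa using C_mul_mul x 1

theorem inner_mul_mul (x y z : Oct) :
    inner ℝ (x * y) (x * z) = inner ℝ x x * inner ℝ y z := by
  rw [inner_mul_left_C, C_mul_mul, real_inner_smul_right]

theorem norm_mul_oct (x y : Oct) : ‖x * y‖ = ‖x‖ * ‖y‖ := by
  rw [norm_eq_sqrt_real_inner, inner_mul_mul, inner_self_eq, inner_self_eq, ← mul_pow,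
    Real.sqrt_sq (by positivity)]

theorem mul_C_mul_add (x y z : Oct) :
    x * (C y * z) + y * (C x * z) = (2 * inner ℝ x y : ℝ) • z := by
  have h := mul_C_mul (x + y) z
  simp only [map_add, add_mul, mul_add, mul_C_mul, inner_add_left, inner_add_right, add_smul,
    real_inner_comm x y] at h
  rw [two_mul, add_smul]
  linear_combination (norm := module) h

instance : Nontrivial Oct := ⟨1, 0, fun h => by simpa using congrArg Oct.fst h⟩

@[simp] theorem norm_one_oct : ‖(1 : Oct)‖ = 1 := by
  rw [norm_eq_sqrt_real_inner, Oct.inner_eq]; simp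

theorem one_ne_zero_oct : (1 : Oct) ≠ 0 := fun h => by simpa [h] using norm_one_oct

instance : FiniteDimensional ℝ Oct :=
  inferInstanceAs (FiniteDimensional ℝ (WithLp 2 (Quaternion ℝ × Quaternion ℝ)))

instance : FiniteDimensional ℝ Oct2 :=
  inferInstanceAs (FiniteDimensional ℝ (WithLp 2 (Oct × Oct)))

theorem finrank_oct : Module.finrank ℝ Oct = 8 := by
  have : Module.finrank ℝ Oct = Module.finrank ℝ (Quaternion ℝ × Quaternion ℝ) :=
    (WithLp.linearEquiv 2 ℝ (Quaternion ℝ × Quaternion ℝ)).finrank_eq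
  rw [this, Module.finrank_prod, Quaternion.finrank_eq_four]

theorem finrank_oct2 : Module.finrank ℝ Oct2 = 16 := by
  have : Module.finrank ℝ Oct2 = Module.finrank ℝ (Oct × Oct) :=
    (WithLp.linearEquiv 2 ℝ (Oct × Oct)).finrank_eq
  rw [this, Module.finrank_prod, finrank_oct]

/-! ### The nucleus of the octonions -/

/-- Commuting with i kills the j and k components, commuting with j kills the i component. -/
theorem quaternion_eq_coe_of_commute {p : ℍ[ℝ]} (h : ∀ a : ℍ[ℝ], a * p = p * a) :
    p = (p.re : ℍ[ℝ]) := by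
  obtain ⟨i, i0, i1, i2, i3⟩ : ∃ i : ℍ[ℝ], i.re = 0 ∧ i.imI = 1 ∧ i.imJ = 0 ∧ i.imK = 0 :=
    ⟨⟨0, 1, 0, 0⟩, rfl, rfl, rfl, rfl⟩
  obtain ⟨j, j0, j1, j2, j3⟩ : ∃ j : ℍ[ℝ], j.re = 0 ∧ j.imI = 0 ∧ j.imJ = 1 ∧ j.imK = 0 :=
    ⟨⟨0, 0, 1, 0⟩, rfl, rfl, rfl, rfl⟩
  have h1 : (i * p).imJ = (p * i).imJ := by rw [h]
  have h2 : (i * p).imK = (p * i).imK := by rw [h]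
  have h3 : (j * p).imK = (p * j).imK := by rw [h]
  simp only [Quaternion.imJ_mul, Quaternion.imK_mul, i0, i1, i2, i3, j0, j1, j2, j3] at h1 h2 h3
  refine Quaternion.ext p (p.re : ℍ[ℝ]) (Quaternion.re_coe p.re).symm ?_ ?_ ?_
  · exact (by linarith : p.imI = 0).trans (Quaternion.imI_coe p.re).symm
  · exact (by linarith : p.imJ = 0).trans (Quaternion.imJ_coe p.re).symm
  · exact (by linarith : p.imK = 0).trans (Quaternion.imK_coe p.re).symm

theorem exists_quaternion_mul_ne : ∃ a b : ℍ[ℝ], a * b ≠ b * a := by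
  by_contra! h
  have h1 := congrArg QuaternionAlgebra.imI
    (quaternion_eq_coe_of_commute (p := ⟨0, 1, 0, 0⟩) fun a => h a _)
  simp only [Quaternion.imI_coe] at h1
  exact one_ne_zero h1

/-- Two non-commuting quaternions x, y kill the second component of c; then x = (0, 1) makes the
first component central in the quaternions. -/
theorem eq_smul_one_of_right_nucleus {c : Oct} (h : ∀ x y : Oct, (x * y) * c = x * (y * c)) :
    c = c.fst.re • (1 : Oct) := by
  obtain ⟨a, b, hab⟩ := exists_quaternion_mul_ne
  have h0 : c.snd = 0 := by
    have := congrArg Oct.snd (h (Oct.mk a 0) (Oct.mk b 0))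
    simp only [mul_fst, mul_snd, mk_fst, mk_snd, star_zero, zero_mul, sub_zero, add_zero,
      mul_assoc, mul_zero] at this
    exact (mul_eq_zero.1 (by rw [mul_sub, this, sub_self] :
      c.snd * (a * b - b * a) = 0)).resolve_right (sub_ne_zero.2 hab)
  have hc := quaternion_eq_coe_of_commute (p := c.fst) fun a => by
    have := congrArg Oct.snd (h (Oct.mk 0 1) (Oct.mk a 0))
    simp [h0] at this
    simpa using congrArg star this.symm
  ext1
  · rw [smul_fst, one_fst, ← Algebra.algebraMap_eq_smul_one]; exact hc
  · simp [h0]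

theorem eq_smul_one_of_middle_nucleus {c : Oct} (h : ∀ x y : Oct, (x * c) * y = x * (c * y)) :
    c = c.fst.re • (1 : Oct) := by
  obtain ⟨a, b, hab⟩ := exists_quaternion_mul_ne
  have h0 : c.snd = 0 := by
    have := congrArg Oct.snd (h (Oct.mk a 0) (Oct.mk (star b) 0))
    simp only [mul_fst, mul_snd, mk_fst, mk_snd, star_zero, zero_mul, sub_zero, add_zero, zero_add,
      mul_assoc, mul_zero, star_star] at this
    exact (mul_eq_zero.1 (by rw [mul_sub, this, sub_self] :
      c.snd * (a * b - b * a) = 0)).resolve_right (sub_ne_zero.2 hab)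
  have hc := quaternion_eq_coe_of_commute (p := c.fst) fun a => by
    have := congrArg Oct.snd (h (Oct.mk 0 1) (Oct.mk a 0))
    simp [h0] at this
    simpa using congrArg star this
  ext1
  · rw [smul_fst, one_fst, ← Algebra.algebraMap_eq_smul_one]; exact hc
  · simp [h0]

/-! ### The Clifford operators -/

namespace Oct2

@[simp] theorem zero_fst : (0 : Oct2).fst = 0 := rfl
@[simp] theorem zero_snd : (0 : Oct2).snd = 0 := rfl
@[simp] theorem neg_fst (v : Oct2) : (-v).fst = -v.fst := rfl
@[simp] theorem neg_snd (v : Oct2) : (-v).snd = -v.snd := rfl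
@[simp] theorem sub_fst (v w : Oct2) : (v - w).fst = v.fst - w.fst := rfl
@[simp] theorem sub_snd (v w : Oct2) : (v - w).snd = v.snd - w.snd := rfl

theorem inner_eq (v w : Oct2) :
    inner ℝ v w = inner ℝ v.fst w.fst + inner ℝ v.snd w.snd :=
  WithLp.prod_inner_apply (𝕜 := ℝ) (E := Oct) (F := Oct) v w

theorem norm_sq_eq (v : Oct2) : ‖v‖ ^ 2 = ‖v.fst‖ ^ 2 + ‖v.snd‖ ^ 2 := by
  rw [← real_inner_self_eq_norm_sq, inner_eq, real_inner_self_eq_norm_sq,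
    real_inner_self_eq_norm_sq]

end Oct2

/-- The space `ℝ ⊕ O`. -/
abbrev Vec9 : Type := WithLp 2 (ℝ × Oct)

namespace Vec9

def mk (r : ℝ) (x : Oct) : Vec9 := WithLp.toLp 2 (r, x)

@[simp] theorem mk_fst (r : ℝ) (x : Oct) : (mk r x).fst = r := rfl
@[simp] theorem mk_snd (r : ℝ) (x : Oct) : (mk r x).snd = x := rfl

theorem ext {v w : Vec9} (h : v.fst = w.fst) (h' : v.snd = w.snd) : v = w :=
  WithLp.ofLp_injective 2 (Prod.ext h h')

theorem inner_eq (v w : Vec9) : inner ℝ v w = v.fst * w.fst + inner ℝ v.snd w.snd := by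
  rw [WithLp.prod_inner_apply]
  simp [mul_comm]

theorem norm_sq_eq (v : Vec9) : ‖v‖ ^ 2 = v.fst ^ 2 + ‖v.snd‖ ^ 2 := by
  rw [← real_inner_self_eq_norm_sq, inner_eq, real_inner_self_eq_norm_sq, sq v.fst]

end Vec9

/-- The real operator `[[r, C R_x̄], [C L_x̄, -r]]`, indexed so that `⟨T w v, v⟩ = ⟨w, σ v⟩`. -/
def T (w : Vec9) : Oct2 →ₗ[ℝ] Oct2 := blockMap w.fst (C w.snd)

theorem T_fst (w : Vec9) (v : Oct2) : (T w v).fst = w.fst • v.fst + w.snd * C v.snd := by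
  change w.fst • v.fst + C (v.snd * C w.snd) = _
  rw [C_mul, C_C]

theorem T_snd (w : Vec9) (v : Oct2) : (T w v).snd = C v.fst * w.snd - w.fst • v.snd := by
  change C (C w.snd * v.fst) - w.fst • v.snd = _
  rw [C_mul, C_C]

theorem T_add (u w : Vec9) : T (u + w) = T u + T w := by
  ext v <;> simp only [LinearMap.add_apply, Oct2.add_fst, Oct2.add_snd, T_fst, T_snd,
    WithLp.add_fst, WithLp.add_snd, add_smul, add_mul, mul_add] <;> abel_nf

theorem T_neg (w : Vec9) : T (-w) = -T w := by
  apply LinearMap.ext; intro v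
  apply Oct2.ext <;> simp only [LinearMap.neg_apply, Oct2.neg_fst, Oct2.neg_snd, T_fst, T_snd,
    WithLp.neg_fst, WithLp.neg_snd, neg_smul, neg_mul, mul_neg] <;> abel

/-- The off-diagonal terms cancel and the diagonal ones are x(x̄y) = |x|²y and its mirror image;
this needs no associativity. -/
theorem T_T (w : Vec9) (v : Oct2) : T w (T w v) = (inner ℝ w w : ℝ) • v := by
  apply Oct2.ext
  · simp only [T_fst, T_snd, map_sub, C_mul, C_C, map_smul, mul_sub, mul_C_mul, Oct2.smul_fst,
      Vec9.inner_eq, mul_smul_comm]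
    module
  · simp only [T_fst, T_snd, map_add, C_mul, C_C, map_smul, add_mul, Oct2.smul_snd,
      Vec9.inner_eq, smul_mul_assoc]
    rw [show v.snd * C w.snd * w.snd = (inner ℝ w.snd w.snd : ℝ) • v.snd by
      simpa [inner_C_C] using mul_mul_C (C w.snd) v.snd]
    module

theorem T_anticomm (u w : Vec9) (v : Oct2) :
    T u (T w v) + T w (T u v) = (2 * inner ℝ u w : ℝ) • v := by
  have h := T_T (u + w) v
  simp only [T_add, LinearMap.add_apply, map_add, T_T, inner_add_left, inner_add_right,
    real_inner_comm u w] at h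
  linear_combination (norm := module) h

theorem inner_T (w : Vec9) (v v' : Oct2) : inner ℝ (T w v) v' = inner ℝ v (T w v') := by
  simp only [Oct2.inner_eq, T_fst, T_snd, inner_add_left, inner_add_right, inner_sub_left,
    inner_sub_right, real_inner_smul_left, real_inner_smul_right]
  have h1 : inner ℝ (w.snd * C v.snd) v'.fst = inner ℝ v.snd (C v'.fst * w.snd) := by
    rw [inner_mul_left_C, inner_C_left, C_mul, C_C]
  have h2 : inner ℝ (C v.fst * w.snd) v'.snd = inner ℝ v.fst (w.snd * C v'.snd) := by
    rw [inner_mul_right_C, inner_C_left, C_mul, C_C]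
  rw [h1, h2]
  ring

theorem inner_T_self (w : Vec9) (v : Oct2) : inner ℝ (T w v) v = inner ℝ w (σ v) := by
  rw [Oct2.inner_eq, T_fst, T_snd, Vec9.inner_eq]
  change _ = w.fst * (‖v.fst‖ ^ 2 - ‖v.snd‖ ^ 2) + inner ℝ w.snd ((2 : ℝ) • (v.fst * v.snd))
  have h1 : inner ℝ (w.snd * C v.snd) v.fst = inner ℝ w.snd (v.fst * v.snd) := by
    rw [inner_mul_right_C, C_C]
  have h2 : inner ℝ (C v.fst * w.snd) v.snd = inner ℝ w.snd (v.fst * v.snd) := by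
    rw [inner_mul_left_C, C_C]
  rw [inner_add_left, inner_sub_left, real_inner_smul_left, real_inner_smul_left,
    real_inner_smul_right, h1, h2, inner_self_eq, inner_self_eq]
  ring

theorem norm_T {w : Vec9} (hw : ‖w‖ = 1) (v : Oct2) : ‖T w v‖ = ‖v‖ := by
  have h : inner ℝ (T w v) (T w v) = (inner ℝ v v : ℝ) := by
    rw [inner_T, T_T, real_inner_self_eq_norm_sq w, hw, one_pow, one_smul]
  rw [norm_eq_sqrt_real_inner, h, ← norm_eq_sqrt_real_inner]

theorem T_T_of_norm {w : Vec9} (hw : ‖w‖ = 1) (v : Oct2) : T w (T w v) = v := by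
  rw [T_T, real_inner_self_eq_norm_sq w, hw, one_pow, one_smul]

/-- The squaring map intertwines `T w` with a half-turn of `ℝ ⊕ O`. -/
theorem σ_T {w : Vec9} (hw : ‖w‖ = 1) (v : Oct2) :
    σ (T w v) = (2 * inner ℝ w (σ v) : ℝ) • w - σ v := by
  refine ext_inner_left ℝ fun u => ?_
  have h := T_anticomm u w (T w v)
  rw [T_T_of_norm hw] at h
  -- By duality it suffices to compute ⟨T u T w v, T w v⟩, moving `T w` across the inner product and
  -- using the anticommutator.
  rw [← inner_T_self, ← T_T_of_norm hw (T u (T w v)), inner_T, T_T_of_norm hw,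
    eq_sub_of_add_eq' h, inner_sub_left, real_inner_smul_left, inner_T_self, inner_T_self,
    inner_sub_right, real_inner_smul_right]
  ring

/-! ### The generators of `Spin(9)` -/

/-- The operator `T u ∘ T w` for unit vectors `u`, `w`. -/
def TT (u w : Vec9) (hu : ‖u‖ = 1) (hw : ‖w‖ = 1) : GLOct2 where
  val := (T u ∘ₗ T w).toContinuousLinearMap
  inv := (T w ∘ₗ T u).toContinuousLinearMap
  val_inv := by
    ext1 v
    change T u (T w (T w (T u v))) = v
    rw [T_T_of_norm hw, T_T_of_norm hu]
  inv_val := by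
    ext1 v
    change T w (T u (T u (T w v))) = v
    rw [T_T_of_norm hu, T_T_of_norm hw]

@[simp] theorem TT_apply (u w : Vec9) (hu : ‖u‖ = 1) (hw : ‖w‖ = 1) (v : Oct2) :
    (TT u w hu hw : Oct2 →L[ℝ] Oct2) v = T u (T w v) := rfl

/-- The real part ℂ → ℝ induces a left inverse of v ↦ 1 ⊗ v. -/
theorem baseChange_injective {A B : Oct2 →ₗ[ℝ] Oct2}
    (h : A.baseChange ℂ = B.baseChange ℂ) : A = B := by
  ext1 v
  have h1 := LinearMap.congr_fun h (1 ⊗ₜ v)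
  rw [LinearMap.baseChange_tmul, LinearMap.baseChange_tmul] at h1
  have h2 := congrArg (fun z => TensorProduct.lid ℝ Oct2 (Complex.reLm.rTensor Oct2 z)) h1
  simpa using h2

theorem m_comp_m (r : ℝ) (x : Oct) (s : ℝ) (y : Oct) :
    m r x ∘ₗ m s y = (-(T (Vec9.mk r (C x)) ∘ₗ T (Vec9.mk s (C y)))).baseChange ℂ := by
  have h : ∀ (r : ℝ) (x : Oct), T (Vec9.mk r (C x)) = blockMap r x := fun r x => by
    rw [T, Vec9.mk_fst, Vec9.mk_snd, C_C]
  rw [h, h, LinearMap.baseChange_neg, LinearMap.baseChange_comp]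
  simp only [m, LinearMap.smul_comp, LinearMap.comp_smul, smul_smul, Complex.I_mul_I]
  rw [neg_one_smul]

theorem norm_mk_eq_one {r : ℝ} {x : Oct} (h : r ^ 2 + ‖x‖ ^ 2 = 1) : ‖Vec9.mk r x‖ = 1 := by
  have := Vec9.norm_sq_eq (Vec9.mk r x)
  rw [Vec9.mk_fst, Vec9.mk_snd, h] at this
  exact (pow_eq_one_iff_of_nonneg (norm_nonneg _) two_ne_zero).1 this

theorem TT_mem (u w : Vec9) (hu : ‖u‖ = 1) (hw : ‖w‖ = 1) : TT u w hu hw ∈ Spin9 := by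
  -- The factor i² = -1 in the product of two Clifford multiplications is absorbed by replacing u by
  -- the unit vector -u.
  refine Subgroup.subset_closure ⟨-u.fst, C (-u.snd), w.fst, C w.snd, ?_, ?_, ?_⟩
  · rw [norm_C, norm_neg, neg_sq, ← Vec9.norm_sq_eq, hu, one_pow]
  · rw [norm_C, ← Vec9.norm_sq_eq, hw, one_pow]
  · rw [m_comp_m, C_C, C_C, show Vec9.mk (-u.fst) (-u.snd) = -u from rfl,
      show Vec9.mk w.fst w.snd = w from rfl, T_neg, LinearMap.neg_comp, neg_neg]
    rfl

theorem Spin9_induction {p : GLOct2 → Prop}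
    (hT : ∀ u w hu hw, p (TT u w hu hw)) (h1 : p 1) (hm : ∀ a b, p a → p b → p (a * b))
    (hi : ∀ a, p a → p a⁻¹) {g : GLOct2} (hg : g ∈ Spin9) : p g := by
  induction hg using Subgroup.closure_induction with
  | one => exact h1
  | mul a b _ _ ha hb => exact hm a b ha hb
  | inv a _ ha => exact hi a ha
  | mem g hg =>
    obtain ⟨r, x, s, y, hr, hs, h⟩ := hg
    rw [m_comp_m, ← LinearMap.neg_comp, ← T_neg] at h
    have hr' : ‖-Vec9.mk r (C x)‖ = 1 := by
      rw [norm_neg]; exact norm_mk_eq_one (by rwa [norm_C])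
    have hs' : ‖Vec9.mk s (C y)‖ = 1 := norm_mk_eq_one (by rwa [norm_C])
    convert hT _ _ hr' hs'
    ext1
    exact ContinuousLinearMap.coe_injective (baseChange_injective h)

/-! ### `Spin(9)` lies in `SO(16)` -/

theorem det_neg_of_even {V : Type*} [AddCommGroup V] [Module ℝ V] (f : V →ₗ[ℝ] V)
    (h : Even (Module.finrank ℝ V)) : LinearMap.det (-f) = LinearMap.det f := by
  rw [← neg_one_smul ℝ f, LinearMap.det_smul, h.neg_one_pow, one_mul]

/-- If u + w ≠ 0, the invertible operator `T (u + w)` conjugates `T u` into `T w`, so their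
determinants agree; if w = -u, the even dimension gives the same. As `T w` is an involution, the
common value squares to 1. -/
theorem det_T_mul_det_T (u w : Vec9) (hu : ‖u‖ = 1) (hw : ‖w‖ = 1) :
    LinearMap.det (T u) * LinearMap.det (T w) = 1 := by
  have hww : LinearMap.det (T w) * LinearMap.det (T w) = 1 := by
    rw [← LinearMap.det_comp, show T w ∘ₗ T w = LinearMap.id from
      LinearMap.ext (T_T_of_norm hw), LinearMap.det_id]
  by_cases h : u + w = 0
  · rw [eq_neg_of_add_eq_zero_left h, T_neg, det_neg_of_even _ (by rw [finrank_oct2]; decide), hww]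
  · have hn : LinearMap.det (T (u + w)) * LinearMap.det (T (u + w)) ≠ 0 := by
      rw [← LinearMap.det_comp, show T (u + w) ∘ₗ T (u + w) =
        (inner ℝ (u + w) (u + w) : ℝ) • LinearMap.id from LinearMap.ext (T_T _), LinearMap.det_smul]
      simp [h]
    have hc : T (u + w) ∘ₗ T u = T w ∘ₗ T (u + w) := by
      ext1 v
      simp only [LinearMap.comp_apply, T_add, LinearMap.add_apply, map_add, T_T_of_norm hu,
        T_T_of_norm hw]
      abel
    have hd := congrArg LinearMap.det hc
    rw [LinearMap.det_comp, LinearMap.det_comp, mul_comm] at hd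
    rw [mul_right_cancel₀ (left_ne_zero_of_mul hn) hd, hww]

theorem Spin9_le_SO16 : Spin9 ≤ SO16 := fun _ hg =>
  Spin9_induction (p := (· ∈ SO16))
    (fun u w hu hw => ⟨fun v => by rw [TT_apply, norm_T hu, norm_T hw],
      (LinearMap.det_comp (T u) (T w)).trans (det_T_mul_det_T u w hu hw)⟩)
    (one_mem _) (fun _ _ => mul_mem) (fun _ => inv_mem) hg

/-! ### Equivariance of the squaring map -/

/-- The half-turn of `ℝ ⊕ O` about a unit vector `w`. -/
def halfTurn (w : Vec9) : Vec9 ≃ₗᵢ[ℝ] Vec9 := (ℝ ∙ w).reflection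

theorem halfTurn_apply {w : Vec9} (hw : ‖w‖ = 1) (z : Vec9) :
    halfTurn w z = (2 * inner ℝ w z : ℝ) • w - z := by
  rw [halfTurn, Submodule.reflection_singleton_apply]
  simp [hw, mul_smul, two_smul]

theorem exists_σ_equivariant {g : GLOct2} (hg : g ∈ Spin9) :
    ∃ ρ : Vec9 ≃ₗᵢ[ℝ] Vec9, ∀ v : Oct2, σ ((g : Oct2 →L[ℝ] Oct2) v) = ρ (σ v) := by
  refine Spin9_induction (p := fun g => ∃ ρ : Vec9 ≃ₗᵢ[ℝ] Vec9,
    ∀ v : Oct2, σ ((g : Oct2 →L[ℝ] Oct2) v) = ρ (σ v)) ?_ ⟨1, fun _ => rfl⟩ ?_ ?_ hg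
  · intro u w hu hw
    refine ⟨halfTurn u * halfTurn w, fun v => ?_⟩
    rw [TT_apply, σ_T hu, σ_T hw, LinearIsometryEquiv.coe_mul, Function.comp_apply, halfTurn_apply hu,
      halfTurn_apply hw]
  · rintro a b ⟨ρ, h⟩ ⟨τ, h'⟩
    exact ⟨ρ * τ, fun v => (h _).trans (congrArg ρ (h' v))⟩
  · rintro a ⟨ρ, h⟩
    refine ⟨ρ⁻¹, fun v => ?_⟩
    have key : (a : Oct2 →L[ℝ] Oct2) ((a⁻¹ : GLOct2).val v) = v :=
      congrArg (fun f : Oct2 →L[ℝ] Oct2 => f v) a.mul_inv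
    conv_rhs => rw [← key, h]
    exact (ρ.symm_apply_apply _).symm

/-! ### Transitivity on spheres -/

theorem exists_T_snd_eq_zero (v : Oct2) : ∃ w : Vec9, ‖w‖ = 1 ∧ (T w v).snd = 0 := by
  suffices h : ∃ w : Vec9, w ≠ 0 ∧ (T w v).snd = 0 by
    obtain ⟨w, hw, h⟩ := h
    refine ⟨(‖w‖⁻¹ : ℝ) • w, norm_smul_inv_norm hw, ?_⟩
    rw [T_snd] at h ⊢
    simp only [WithLp.smul_snd, WithLp.smul_fst, mul_smul_comm, smul_eq_mul, mul_smul, ← smul_sub,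
      h, smul_zero]
  by_cases hv : v.fst = 0
  · refine ⟨Vec9.mk 0 1, fun h => one_ne_zero_oct (congrArg WithLp.snd h), ?_⟩
    simp [T_snd, hv]
  · refine ⟨Vec9.mk (inner ℝ v.fst v.fst) (v.fst * v.snd), fun h => hv ?_, ?_⟩
    · exact inner_self_eq_zero.1 (congrArg WithLp.fst h)
    · rw [T_snd, Vec9.mk_fst, Vec9.mk_snd, C_mul_mul, sub_self]

theorem exists_smul_eq_mk (v : Oct2) :
    ∃ g ∈ Spin9, (g : Oct2 →L[ℝ] Oct2) v = Oct2.mk ((‖v‖ : ℝ) • 1) 0 := by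
  by_cases hv : v = 0
  · exact ⟨1, one_mem _, by rw [hv, norm_zero, zero_smul]; rfl⟩
  obtain ⟨w, hw, h⟩ := exists_T_snd_eq_zero v
  set a := (T w v).fst with ha
  have hTv : T w v = Oct2.mk a 0 := Oct2.ext rfl h
  have hna : ‖a‖ = ‖v‖ := by
    rw [← norm_T hw, hTv]
    have := Oct2.norm_sq_eq (Oct2.mk a 0)
    simp only [Oct2.mk_fst, Oct2.mk_snd, norm_zero] at this
    exact ((pow_left_inj₀ (norm_nonneg _) (norm_nonneg _) two_ne_zero).1 (by linarith)).symm
  have hv' : ‖v‖ ≠ 0 := norm_ne_zero_iff.2 hv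
  have hu : ‖Vec9.mk 0 ((‖v‖⁻¹ : ℝ) • a)‖ = 1 := by
    apply norm_mk_eq_one
    rw [norm_smul, hna]; simp [hv']
  have h1 : ‖Vec9.mk 0 1‖ = 1 := norm_mk_eq_one (by simp)
  have h2 : ‖Vec9.mk 1 0‖ = 1 := norm_mk_eq_one (by simp)
  -- The vector goes to (a, 0), then to (0, |v|), then to (|v|, 0). The last factor `T (1, 0)` fixes
  -- O ⊕ 0 and only makes the number of factors even.
  refine ⟨TT _ _ h2 h1 * TT _ _ hu hw, mul_mem (TT_mem _ _ h2 h1) (TT_mem _ _ hu hw), ?_⟩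
  change T (Vec9.mk 1 0) (T (Vec9.mk 0 1) (T (Vec9.mk 0 ((‖v‖⁻¹ : ℝ) • a)) (T w v))) = _
  have h3 : T (Vec9.mk 0 ((‖v‖⁻¹ : ℝ) • a)) (T w v) = Oct2.mk 0 ((‖v‖ : ℝ) • 1) := by
    rw [hTv]
    apply Oct2.ext
    · simp [T_fst]
    · simp only [T_snd, Oct2.mk_fst, Oct2.mk_snd, Vec9.mk_fst, Vec9.mk_snd, zero_smul, sub_zero,
        mul_smul_comm, C_mul_self, inner_self_eq, hna, smul_smul]
      congr 1
      field_simp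
  rw [h3]
  apply Oct2.ext <;> simp [T_fst, T_snd]

theorem exists_smul_eq_of_norm_eq {v w : Oct2} (h : ‖v‖ = ‖w‖) :
    ∃ g ∈ Spin9, (g : Oct2 →L[ℝ] Oct2) v = w := by
  obtain ⟨a, ha, hav⟩ := exists_smul_eq_mk v
  obtain ⟨b, hb, hbw⟩ := exists_smul_eq_mk w
  refine ⟨b⁻¹ * a, mul_mem (inv_mem hb) ha, ?_⟩
  change (b⁻¹ : GLOct2).val (a.val v) = w
  rw [hav, h, ← hbw]
  exact congrArg (fun f : Oct2 →L[ℝ] Oct2 => f w) b.inv_mul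

theorem orbit_eq_sphere (v : Oct2) (hv : v ∈ Metric.sphere (0 : Oct2) 1) :
    MulAction.orbit Spin9 v = Metric.sphere (0 : Oct2) 1 := by
  rw [mem_sphere_zero_iff_norm] at hv
  ext w
  rw [mem_sphere_zero_iff_norm]
  constructor
  · rintro ⟨g, rfl⟩
    exact ((Spin9_le_SO16 g.2).1 v).trans hv
  · intro hw
    obtain ⟨g, hg, h⟩ := exists_smul_eq_of_norm_eq (hv.trans hw.symm)
    exact ⟨⟨g, hg⟩, h⟩

/-! ### Imaginary units -/

theorem mul_eq_zero_oct {x y : Oct} (h : x * y = 0) : x = 0 ∨ y = 0 := by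
  have := norm_mul_oct x y
  rw [h, norm_zero] at this
  simpa [eq_comm] using this

/-- The unit sphere of the imaginary octonions. -/
abbrev ImUnit : Type := {u : Oct // inner ℝ u 1 = (0 : ℝ) ∧ ‖u‖ = 1}

theorem C_of_inner_eq_zero {u : Oct} (hu : inner ℝ u 1 = (0 : ℝ)) : C u = -u := by
  rw [C_apply, hu, mul_zero, zero_smul, zero_sub]

namespace ImUnit

instance : Neg ImUnit := ⟨fun u => ⟨-u.1, by rw [inner_neg_left, u.2.1, neg_zero], by
  rw [norm_neg, u.2.2]⟩⟩

instance : Nonempty ImUnit := by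
  refine ⟨⟨Oct.mk 0 1, ?_, ?_⟩⟩
  · simp [Oct.inner_eq]
  · rw [norm_eq_sqrt_real_inner, Oct.inner_eq]; simp

theorem C_eq (u : ImUnit) : C u.1 = -u.1 := C_of_inner_eq_zero u.2.1

theorem mul_mul_self (u : ImUnit) (x : Oct) : u.1 * (u.1 * x) = -x := by
  have := C_mul_mul u.1 x
  rw [C_eq, inner_self_eq, u.2.2, one_pow, one_smul, neg_mul] at this
  exact neg_eq_iff_eq_neg.1 this

end ImUnit

/-- Left multiplication by an imaginary unit, as an isometry. -/
def LU (u : ImUnit) : Oct ≃ₗᵢ[ℝ] Oct where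
  toLinearEquiv := LinearEquiv.ofLinearMap (L u.1) (-L u.1)
    (LinearMap.ext fun x => by simp [u.mul_mul_self]) (LinearMap.ext fun x => by
      simp [u.mul_mul_self])
  norm_map' x := by
    change ‖u.1 * x‖ = ‖x‖
    rw [norm_mul_oct, u.2.2, one_mul]

@[simp] theorem LU_apply (u : ImUnit) (x : Oct) : LU u x = u.1 * x := rfl

/-- Conjugation as an isometry. -/
def CI : Oct ≃ₗᵢ[ℝ] Oct := (ℝ ∙ (1 : Oct)).reflection

@[simp] theorem CI_apply (x : Oct) : CI x = C x := by
  rw [CI, Submodule.reflection_singleton_apply, C_apply, real_inner_comm]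
  simp [mul_smul, two_smul]

/-- The reflection of `O` in the hyperplane orthogonal to `u`. -/
def SU (u : Oct) : Oct ≃ₗᵢ[ℝ] Oct := (ℝ ∙ u)ᗮ.reflection

theorem SU_apply {u : Oct} (hu : ‖u‖ = 1) (x : Oct) :
    SU u x = x - (2 * inner ℝ u x : ℝ) • u := by
  rw [SU, Submodule.reflection_orthogonal_apply, Submodule.reflection_singleton_apply]
  simp [hu, mul_smul, two_smul]

/-- The isometry `a ↦ u a u⁻¹`. -/
def CU (u : ImUnit) : Oct ≃ₗᵢ[ℝ] Oct := CI * SU u.1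

theorem CU_apply (u : ImUnit) (x : Oct) : CU u x = C x + (2 * inner ℝ u.1 x : ℝ) • u.1 := by
  rw [CU, LinearIsometryEquiv.coe_mul, Function.comp_apply, SU_apply u.2.2, CI_apply, map_sub,
    map_smul, u.C_eq, smul_neg, sub_neg_eq_add]

@[simp] theorem CU_one (u : ImUnit) : CU u 1 = 1 := by
  rw [CU_apply, u.2.1]; simp

/-- This is the polarized identity x(ȳz) + y(x̄z) = 2⟨x, y⟩z at x = u, y = ā. It says that left
multiplication by u covers conjugation by u. -/
theorem LU_mul (u : ImUnit) (a b : Oct) : LU u (a * b) = CU u a * LU u b := by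
  rw [LU_apply, LU_apply, CU_apply]
  have h := mul_C_mul_add u.1 (C a) b
  rw [C_C, u.C_eq, ← inner_C_left, u.C_eq, inner_neg_left] at h
  rw [add_mul, smul_mul_assoc, u.mul_mul_self]
  simp only [neg_mul, mul_neg] at h
  linear_combination (norm := module) h

theorem commute_CI_SU (u : ImUnit) : Commute CI (SU u.1) := by
  ext1 x
  simp only [LinearIsometryEquiv.coe_mul, Function.comp_apply, SU_apply u.2.2, CI_apply, map_sub,
    map_smul, u.C_eq, ← inner_C_left u.1 x, inner_neg_left]
  module

theorem CI_mul_CI : CI * CI = 1 := by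
  ext1 x
  simp [LinearIsometryEquiv.coe_mul]

/-- Each conjugation is a reflection times octonion conjugation, and these commute; only the parity
of the number of factors decides whether an octonion conjugation survives. -/
theorem prod_CU (l : List ImUnit) :
    (l.map CU).prod = CI ^ l.length * (l.map fun u : ImUnit => SU u.1).prod := by
  induction l with
  | nil => simp
  | cons u l ih =>
    rw [List.map_cons, List.prod_cons, ih, List.map_cons, List.prod_cons, CU, List.length_cons,
      pow_succ', mul_assoc, mul_assoc, ← mul_assoc (SU u.1),
      ((commute_CI_SU u).pow_left l.length).symm.eq, mul_assoc]

theorem commute_CI_prod_SU (l : List ImUnit) :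
    Commute CI (l.map fun u : ImUnit => SU u.1).prod :=
  Commute.list_prod_right _ _ fun x hx => by
    obtain ⟨u, -, rfl⟩ := List.mem_map.1 hx
    exact commute_CI_SU u

theorem prod_LU_mul (l : List ImUnit) (a b : Oct) :
    (l.map LU).prod (a * b) = (l.map CU).prod a * (l.map LU).prod b := by
  induction l with
  | nil => rfl
  | cons u l ih =>
    simp only [List.map_cons, List.prod_cons, LinearIsometryEquiv.coe_mul, Function.comp_apply]
    rw [ih, LU_mul]

/-! ### Determinants -/

theorem isSO8_one : IsSO8 1 := LinearMap.det_id

theorem det_mul_isometry (a b : Oct ≃ₗᵢ[ℝ] Oct) :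
    LinearMap.det ((a * b).toLinearEquiv : Oct →ₗ[ℝ] Oct) =
      LinearMap.det (a.toLinearEquiv : Oct →ₗ[ℝ] Oct) *
        LinearMap.det (b.toLinearEquiv : Oct →ₗ[ℝ] Oct) :=
  LinearMap.det_comp (a.toLinearEquiv : Oct →ₗ[ℝ] Oct) (b.toLinearEquiv : Oct →ₗ[ℝ] Oct)

theorem IsSO8.mul {a b : Oct ≃ₗᵢ[ℝ] Oct} (ha : IsSO8 a) (hb : IsSO8 b) : IsSO8 (a * b) := by
  unfold IsSO8 at *
  rw [det_mul_isometry, ha, hb, one_mul]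

theorem isSO8_list_prod {l : List (Oct ≃ₗᵢ[ℝ] Oct)} (h : ∀ g ∈ l, IsSO8 g) : IsSO8 l.prod := by
  induction l with
  | nil => exact isSO8_one
  | cons g l ih =>
    rw [List.prod_cons]
    exact (h g (by simp)).mul (ih fun g' hg' => h g' (by simp [hg']))

instance fact_finrank_oct : Fact (Module.finrank ℝ Oct = 7 + 1) := ⟨finrank_oct⟩

theorem det_SU {u : Oct} (hu : u ≠ 0) :
    LinearMap.det ((SU u).toLinearEquiv : Oct →ₗ[ℝ] Oct) = -1 := by
  have := Submodule.det_reflection (ℝ ∙ u)ᗮ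
  rw [Submodule.orthogonal_orthogonal, finrank_span_singleton hu, pow_one] at this
  exact this

theorem det_CI : LinearMap.det (CI.toLinearEquiv : Oct →ₗ[ℝ] Oct) = -1 := by
  have := Submodule.det_reflection (ℝ ∙ (1 : Oct))
  rw [Submodule.finrank_orthogonal_span_singleton (n := 7) one_ne_zero_oct] at this
  exact this.trans (by norm_num)

theorem isSO8_CU (u : ImUnit) : IsSO8 (CU u) := by
  have hu : u.1 ≠ 0 := norm_ne_zero_iff.1 (by rw [u.2.2]; exact one_ne_zero)
  unfold IsSO8
  rw [CU, det_mul_isometry, det_CI, det_SU hu]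
  norm_num

/-- From L_u² = -1 the determinant is ±1, and (1 + L_u)² = 2L_u makes it nonnegative. -/
theorem isSO8_LU (u : ImUnit) : IsSO8 (LU u) := by
  change LinearMap.det (L u.1) = 1
  have h1 : LinearMap.det (L u.1) * LinearMap.det (L u.1) = 1 := by
    rw [← LinearMap.det_comp, show L u.1 ∘ₗ L u.1 = -LinearMap.id from
      LinearMap.ext fun x => u.mul_mul_self x,
      det_neg_of_even _ (by rw [finrank_oct]; decide), LinearMap.det_id]
  have h2 : LinearMap.det (L (1 + u.1)) * LinearMap.det (L (1 + u.1)) =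
      2 ^ 8 * LinearMap.det (L u.1) := by
    rw [← LinearMap.det_comp, ← finrank_oct, ← LinearMap.det_smul]
    congr 1
    ext1 x
    simp only [LinearMap.comp_apply, L_apply, LinearMap.smul_apply, add_mul, mul_add, one_mul,
      u.mul_mul_self]
    module
  nlinarith [mul_self_nonneg (LinearMap.det (L (1 + u.1)))]

/-! ### Companions of rotations fixing `1` -/

/-- The counterpart of the nucleus for the reversed product; it rules out an odd number of
reflections in `exists_list_of_related`. -/
theorem eq_zero_of_anti_nucleus {c : Oct} (h : ∀ x y : Oct, (y * x) * c = x * (y * c)) :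
    c = 0 := by
  obtain ⟨a, b, hab⟩ := exists_quaternion_mul_ne
  have h0 : c.fst = 0 := by
    have := congrArg Oct.fst (h (Oct.mk b 0) (Oct.mk a 0))
    simp only [mul_fst, mul_snd, mk_fst, mk_snd, star_zero, zero_mul, sub_zero, add_zero,
      mul_zero, ← mul_assoc] at this
    exact (mul_eq_zero.1 (by rw [sub_mul, this, sub_self] :
      (a * b - b * a) * c.fst = 0)).resolve_left (sub_ne_zero.2 hab)
  have h1 : ∀ a : ℍ[ℝ], star c.snd * star a = a * star c.snd := fun a => by
    have := congrArg Oct.fst (h (Oct.mk a 0) (Oct.mk 0 1))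
    simpa [h0] using this
  have h2 : star c.snd = 0 := by
    have : (a * b - b * a) * star c.snd = 0 := by
      rw [sub_mul, mul_assoc a, ← h1 b, ← mul_assoc, ← h1 a, mul_assoc, ← star_mul, h1, sub_self]
    exact (mul_eq_zero.1 this).resolve_left (sub_ne_zero.2 hab)
  ext1
  · exact h0
  · exact star_eq_zero.1 h2

theorem eq_or_eq_neg_of_norm_smul {c : Oct} {r : ℝ} (h : c = r • (1 : Oct)) (hc : ‖c‖ = 1) :
    c = 1 ∨ c = -1 := by
  rw [h, norm_smul, norm_one_oct, mul_one, Real.norm_eq_abs] at hc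
  rcases eq_or_eq_neg_of_abs_eq hc with hr | hr
  · left; rw [h, hr, one_smul]
  · right; rw [h, hr, neg_one_smul]

/-- Every product of reflections of the imaginary octonions is, on these, a product of reflections
in hyperplanes orthogonal to imaginary units. -/
theorem exists_imUnit_list (l : List (ℝ ∙ (1 : Oct))ᗮ) :
    ∃ l' : List ImUnit, l'.length ≤ l.length ∧ ∀ x : (ℝ ∙ (1 : Oct))ᗮ,
      (((l.map fun v => (ℝ ∙ v)ᗮ.reflection).prod x : (ℝ ∙ (1 : Oct))ᗮ) : Oct) =
        (l'.map fun u : ImUnit => SU u.1).prod x := by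
  induction l with
  | nil => exact ⟨[], le_rfl, fun x => rfl⟩
  | cons v l ih =>
    obtain ⟨l', hl, h⟩ := ih
    by_cases hv : v = 0
    · refine ⟨l', hl.trans (by simp), fun x => ?_⟩
      rw [← h, List.map_cons, List.prod_cons, LinearIsometryEquiv.coe_mul, Function.comp_apply,
        Submodule.reflection_mem_subspace_eq_self]
      rw [hv, Submodule.span_zero_singleton, Submodule.bot_orthogonal_eq_top]
      trivial
    · have hv0 : (v : Oct) ≠ 0 := fun h => hv (Subtype.ext h)
      have hv1 : inner ℝ (v : Oct) 1 = (0 : ℝ) := by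
        rw [real_inner_comm]; exact Submodule.mem_orthogonal_singleton_iff_inner_right.1 v.2
      have hn : ‖(‖(v : Oct)‖⁻¹ : ℝ) • (v : Oct)‖ = 1 := norm_smul_inv_norm hv0
      refine ⟨⟨(‖(v : Oct)‖⁻¹ : ℝ) • (v : Oct), ?_, ?_⟩ :: l', by simpa using hl, fun x => ?_⟩
      · rw [real_inner_smul_left, hv1, mul_zero]
      · exact hn
      · rw [List.map_cons, List.prod_cons, List.map_cons, List.prod_cons,
          LinearIsometryEquiv.coe_mul, LinearIsometryEquiv.coe_mul, Function.comp_apply,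
          Function.comp_apply, ← h, SU_apply hn,
          Submodule.reflection_orthogonal_apply, Submodule.reflection_singleton_apply]
        simp only [Submodule.coe_sub, Submodule.coe_smul, Submodule.coe_inner,
          Submodule.coe_norm, real_inner_smul_left, smul_smul, two_smul, neg_sub,
          RCLike.ofReal_real_eq_id, id, ← add_smul]
        congr 2
        have := norm_ne_zero_iff.2 hv0
        field_simp
        ring

/-- Cartan–Dieudonné on the 7-dimensional space of imaginary octonions, extended by the identity on
ℝ1. -/
theorem exists_prod_SU (g : Oct ≃ₗᵢ[ℝ] Oct) (h1 : g 1 = 1) :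
    ∃ l : List ImUnit, l.length ≤ 7 ∧ (l.map fun u : ImUnit => SU u.1).prod = g := by
  have hmem : ∀ x : Oct, x ∈ (ℝ ∙ (1 : Oct))ᗮ ↔ g x ∈ (ℝ ∙ (1 : Oct))ᗮ := fun x => by
    rw [Submodule.mem_orthogonal_singleton_iff_inner_right,
      Submodule.mem_orthogonal_singleton_iff_inner_right, ← g.inner_map_map 1 x, h1]
  have hmap : (ℝ ∙ (1 : Oct))ᗮ.map (g.toLinearEquiv : Oct →ₗ[ℝ] Oct) = (ℝ ∙ (1 : Oct))ᗮ := by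
    ext y
    constructor
    · rintro ⟨x, hx, rfl⟩
      exact (hmem x).1 hx
    · intro hy
      exact ⟨g.symm y, (hmem _).2 (by rwa [g.apply_symm_apply]), g.apply_symm_apply y⟩
  let φ : (ℝ ∙ (1 : Oct))ᗮ ≃ₗᵢ[ℝ] (ℝ ∙ (1 : Oct))ᗮ :=
    { toLinearEquiv := g.toLinearEquiv.ofSubmodules _ _ hmap
      norm_map' := fun x => g.norm_map x }
  obtain ⟨l, hl, hφ⟩ := φ.reflections_generate_dim
  rw [Submodule.finrank_orthogonal_span_singleton (n := 7) one_ne_zero_oct] at hl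
  obtain ⟨l', hl', h⟩ := exists_imUnit_list l
  refine ⟨l', hl'.trans hl, ?_⟩
  have hone : ∀ l : List ImUnit, (l.map fun u : ImUnit => SU u.1).prod 1 = 1 := fun l => by
    induction l with
    | nil => rfl
    | cons u l ih =>
      rw [List.map_cons, List.prod_cons, LinearIsometryEquiv.coe_mul, Function.comp_apply, ih,
        SU_apply u.2.2, u.2.1]
      simp
  ext1 x
  obtain ⟨y, hy, z, hz, rfl⟩ := Submodule.exists_add_mem_mem_orthogonal (K := ℝ ∙ (1 : Oct)) x
  obtain ⟨r, rfl⟩ := Submodule.mem_span_singleton.1 hy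
  rw [map_add, map_add, map_smul, map_smul, hone, h1, ← h ⟨z, hz⟩, ← hφ]
  rfl

theorem LU_mul_LU_self (u : ImUnit) (x : Oct) : (LU u * LU u) x = -x := u.mul_mul_self x

theorem LU_mul_LU_neg (u : ImUnit) : LU u * LU (-u) = 1 := by
  ext1 x
  change u.1 * (-u.1 * x) = x
  rw [neg_mul, mul_neg, u.mul_mul_self, neg_neg]

theorem exists_list_length_add (l : List ImUnit) (n : ℕ) : ∃ l' : List ImUnit,
    l'.length = l.length + 2 * n ∧ (l'.map LU).prod = (l.map LU).prod := by
  induction n with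
  | zero => exact ⟨l, rfl, rfl⟩
  | succ n ih =>
    obtain ⟨l', hl, h⟩ := ih
    obtain ⟨u⟩ : Nonempty ImUnit := inferInstance
    refine ⟨u :: (-u) :: l', by simp [hl]; ring, ?_⟩
    rw [List.map_cons, List.prod_cons, List.map_cons, List.prod_cons, ← mul_assoc, LU_mul_LU_neg,
      one_mul, h]

/-- An isometry `g₃` with `g₃ (a b) = g₁ a · g₃ b` and `g₁ 1 = 1` is a product of eight left
multiplications by imaginary units, and `g₁` is the corresponding product of conjugations. -/
theorem exists_list_of_related {g₁ g₃ : Oct ≃ₗᵢ[ℝ] Oct} (h1 : g₁ 1 = 1)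
    (h : ∀ a b, g₃ (a * b) = g₁ a * g₃ b) :
    ∃ l : List ImUnit, l.length = 8 ∧ (l.map LU).prod = g₃ ∧ (l.map CU).prod = g₁ := by
  suffices H : ∃ l : List ImUnit, l.length = 8 ∧ (l.map LU).prod = g₃ by
    obtain ⟨l, hl, hg⟩ := H
    refine ⟨l, hl, hg, ?_⟩
    ext1 a
    have := prod_LU_mul l a 1
    rw [hg, h, ← sub_eq_zero, ← sub_mul] at this
    rcases mul_eq_zero_oct this with h' | h'
    · exact (sub_eq_zero.1 h').symm
    · exact absurd ((map_eq_zero_iff g₃ g₃.injective).1 h') one_ne_zero_oct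
  obtain ⟨l, hl, hS⟩ := exists_prod_SU g₁ h1
  set P := (l.map LU).prod with hP
  set G := (l.map CU).prod with hG
  have hPG : ∀ a b, P (a * b) = G a * P b := prod_LU_mul l
  have hG' := prod_CU l
  rw [← hG, hS] at hG'
  have hk : ∀ b, P (P.symm (g₃ b)) = g₃ b := fun b => P.apply_symm_apply _
  rcases Nat.even_or_odd l.length with he | ho
  · have hGg : G = g₁ := by
      obtain ⟨n, hn⟩ := he
      rw [hG', hn, ← two_mul, pow_mul, sq, CI_mul_CI, one_pow, one_mul]
    -- `P` and `g₃` cover the same `g₁`, so P⁻¹g₃ commutes with all left multiplications. It is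
    -- therefore right multiplication by a unit c in the right nucleus, that is, by ±1.
    have hkm : ∀ a b, P.symm (g₃ (a * b)) = a * P.symm (g₃ b) := fun a b => by
      rw [LinearIsometryEquiv.symm_apply_eq, hPG, hGg, hk, h]
    have hk1 : ∀ a, P.symm (g₃ a) = a * P.symm (g₃ 1) := fun a => by
      simpa using hkm a 1
    have hc := eq_smul_one_of_right_nucleus (c := P.symm (g₃ 1)) fun x y => by
      rw [← hk1, ← hk1, hkm]
    have hnorm : ‖P.symm (g₃ 1)‖ = 1 := by
      rw [LinearIsometryEquiv.norm_map, LinearIsometryEquiv.norm_map, norm_one_oct]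
    -- An even length at most 7 is at most 6, which leaves room for two factors u, u with product
    -- -1. Eight is thus a length that serves both signs.
    have hl6 : l.length ≤ 6 := by
      obtain ⟨n, hn⟩ := he
      omega
    rcases eq_or_eq_neg_of_norm_smul hc hnorm with hc1 | hc1
    · obtain ⟨l', hl', h'⟩ := exists_list_length_add l ((8 - l.length) / 2)
      refine ⟨l', by obtain ⟨n, hn⟩ := he; omega, ?_⟩
      rw [h', ← hP]
      ext1 a
      rw [← hk a, hk1, hc1, mul_one]
    · obtain ⟨u⟩ : Nonempty ImUnit := inferInstance
      obtain ⟨l', hl', h'⟩ := exists_list_length_add (u :: u :: l) ((6 - l.length) / 2)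
      refine ⟨l', by obtain ⟨n, hn⟩ := he; simp at hl'; omega, ?_⟩
      rw [h', List.map_cons, List.prod_cons, List.map_cons, List.prod_cons, ← hP, ← mul_assoc]
      ext1 a
      rw [LinearIsometryEquiv.coe_mul, Function.comp_apply, LU_mul_LU_self, ← hk a, hk1, hc1,
        mul_neg, mul_one, map_neg]
  -- For odd length `P` covers `g₁` composed with octonion conjugation, and the same comparison puts
  -- the unit vector c in the anti-nucleus, which is zero.
  · exfalso
    have hGg : ∀ a, G (C a) = g₁ a := fun a => by
      obtain ⟨n, hn⟩ := ho
      rw [hn, pow_succ, pow_mul, sq, CI_mul_CI, one_pow, one_mul, ← hS,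
        (commute_CI_prod_SU l).eq] at hG'
      rw [hG', LinearIsometryEquiv.coe_mul, Function.comp_apply, CI_apply, C_C, hS]
    have hkm : ∀ a b, P.symm (g₃ (a * b)) = C a * P.symm (g₃ b) := fun a b => by
      rw [LinearIsometryEquiv.symm_apply_eq, hPG, hGg, hk, h]
    have hk1 : ∀ a, P.symm (g₃ a) = C a * P.symm (g₃ 1) := fun a => by
      simpa using hkm a 1
    have hc := eq_zero_of_anti_nucleus (c := P.symm (g₃ 1)) fun x y => by
      have := hkm (C x) (C y)
      rwa [hk1, hk1 (C y), C_mul, C_C, C_C] at this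
    have hnorm : ‖P.symm (g₃ 1)‖ = 1 := by
      rw [LinearIsometryEquiv.norm_map, LinearIsometryEquiv.norm_map, norm_one_oct]
    rw [hc, norm_zero] at hnorm
    exact zero_ne_one hnorm

/-! ### The stabilizer of `(1, 0)` -/

theorem GL_inv_apply (g : GLOct2) (v : Oct2) :
    ((g⁻¹ : GLOct2) : Oct2 →L[ℝ] Oct2) ((g : Oct2 →L[ℝ] Oct2) v) = v :=
  congrArg (fun f : Oct2 →L[ℝ] Oct2 => f v) g.inv_mul

theorem GL_apply_inv (g : GLOct2) (v : Oct2) :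
    (g : Oct2 →L[ℝ] Oct2) (((g⁻¹ : GLOct2) : Oct2 →L[ℝ] Oct2) v) = v :=
  congrArg (fun f : Oct2 →L[ℝ] Oct2 => f v) g.mul_inv

theorem GL_ext {g h : GLOct2}
    (H : ∀ v, (g : Oct2 →L[ℝ] Oct2) v = (h : Oct2 →L[ℝ] Oct2) v) : g = h :=
  Units.ext (ContinuousLinearMap.ext H)

@[simp] theorem σ_fst (v : Oct2) : (σ v).fst = ‖v.fst‖ ^ 2 - ‖v.snd‖ ^ 2 := rfl
@[simp] theorem σ_snd (v : Oct2) : (σ v).snd = (2 : ℝ) • (v.fst * v.snd) := rfl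

/-- The operator `(x, y) ↦ (g₁ x, g₃ y)`. -/
def blockDiag (g₁ g₃ : Oct ≃ₗᵢ[ℝ] Oct) : GLOct2 where
  val := LinearMap.toContinuousLinearMap
    { toFun := fun v => Oct2.mk (g₁ v.fst) (g₃ v.snd)
      map_add' := fun v w => by apply Oct2.ext <;> simp
      map_smul' := fun r v => by apply Oct2.ext <;> simp }
  inv := LinearMap.toContinuousLinearMap
    { toFun := fun v => Oct2.mk (g₁.symm v.fst) (g₃.symm v.snd)
      map_add' := fun v w => by apply Oct2.ext <;> simp
      map_smul' := fun r v => by apply Oct2.ext <;> simp }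
  val_inv := ContinuousLinearMap.ext fun v =>
    Oct2.ext (g₁.apply_symm_apply v.fst) (g₃.apply_symm_apply v.snd)
  inv_val := ContinuousLinearMap.ext fun v =>
    Oct2.ext (g₁.symm_apply_apply v.fst) (g₃.symm_apply_apply v.snd)

@[simp] theorem blockDiag_apply (g₁ g₃ : Oct ≃ₗᵢ[ℝ] Oct) (v : Oct2) :
    (blockDiag g₁ g₃ : Oct2 →L[ℝ] Oct2) v = Oct2.mk (g₁ v.fst) (g₃ v.snd) := rfl

theorem isSO8_of_related {g₁ g₃ : Oct ≃ₗᵢ[ℝ] Oct} (h1 : g₁ 1 = 1)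
    (h : ∀ a b, g₃ (a * b) = g₁ a * g₃ b) : IsSO8 g₁ ∧ IsSO8 g₃ := by
  obtain ⟨l, -, rfl, rfl⟩ := exists_list_of_related h1 h
  constructor <;> refine isSO8_list_prod fun g hg => ?_ <;>
    obtain ⟨u, -, rfl⟩ := List.mem_map.1 hg
  · exact isSO8_CU u
  · exact isSO8_LU u

/-- Putting x = 1 in the triple relation gives g₂ = g₃, and the determinant conditions follow from
the factorization into imaginary units. -/
theorem mem_K1_iff {g : GLOct2} : g ∈ K1 ↔ ∃ g₁ g₃ : Oct ≃ₗᵢ[ℝ] Oct,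
    g₁ 1 = 1 ∧ (∀ a b, g₃ (a * b) = g₁ a * g₃ b) ∧ g = blockDiag g₁ g₃ := by
  constructor
  · rintro ⟨⟨g₁, g₂, g₃⟩, ⟨-, -, -, h⟩, h1, hg⟩
    obtain rfl : g₂ = g₃ := by
      ext1 b
      have := h 1 b
      simp only at this h1
      rwa [one_mul, h1, one_mul] at this
    exact ⟨g₁, g₂, h1, h, GL_ext hg⟩
  · rintro ⟨g₁, g₃, h1, h, rfl⟩
    obtain ⟨d1, d3⟩ := isSO8_of_related h1 h
    exact ⟨(g₁, g₃, g₃), ⟨d1, d3, d3, h⟩, h1, fun v => rfl⟩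

theorem exists_isometry_of_norm {f : Oct →ₗ[ℝ] Oct} (hf : ∀ x, ‖f x‖ = ‖x‖) :
    ∃ g : Oct ≃ₗᵢ[ℝ] Oct, ∀ x, g x = f x :=
  ⟨LinearIsometry.toLinearIsometryEquiv ⟨f, hf⟩ rfl, fun _ => rfl⟩

/-- An isometry of `O²` that preserves `|x|² - |y|²` is block diagonal. -/
theorem exists_eq_blockDiag {g : GLOct2} (hn : ∀ v, ‖(g : Oct2 →L[ℝ] Oct2) v‖ = ‖v‖)
    (hs : ∀ v, (σ ((g : Oct2 →L[ℝ] Oct2) v)).fst = (σ v).fst) :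
    ∃ g₁ g₃ : Oct ≃ₗᵢ[ℝ] Oct, g = blockDiag g₁ g₃ := by
  -- The sum and the difference of |x|² and |y|² are preserved, hence each of them.
  have hf : ∀ v, ‖((g : Oct2 →L[ℝ] Oct2) v).fst‖ = ‖v.fst‖ ∧
      ‖((g : Oct2 →L[ℝ] Oct2) v).snd‖ = ‖v.snd‖ := fun v => by
    have h1 := Oct2.norm_sq_eq ((g : Oct2 →L[ℝ] Oct2) v)
    rw [hn, Oct2.norm_sq_eq] at h1
    have h2 := hs v
    rw [σ_fst, σ_fst] at h2
    exact ⟨(pow_left_inj₀ (norm_nonneg _) (norm_nonneg _) two_ne_zero).1 (by linarith),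
      (pow_left_inj₀ (norm_nonneg _) (norm_nonneg _) two_ne_zero).1 (by linarith)⟩
  obtain ⟨g₁, h₁⟩ := exists_isometry_of_norm (f :=
    { toFun := fun x => ((g : Oct2 →L[ℝ] Oct2) (Oct2.mk x 0)).fst
      map_add' := fun x y => by
        rw [← Oct2.add_fst, ← map_add]
        exact congrArg (fun w => ((g : Oct2 →L[ℝ] Oct2) w).fst)
          (Oct2.ext rfl (add_zero (0 : Oct)).symm)
      map_smul' := fun r x => by
        rw [RingHom.id_apply, ← Oct2.smul_fst, ← map_smul]
        exact congrArg (fun w => ((g : Oct2 →L[ℝ] Oct2) w).fst)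
          (Oct2.ext rfl (smul_zero r).symm) }) fun x => (hf (Oct2.mk x 0)).1
  obtain ⟨g₃, h₃⟩ := exists_isometry_of_norm (f :=
    { toFun := fun x => ((g : Oct2 →L[ℝ] Oct2) (Oct2.mk 0 x)).snd
      map_add' := fun x y => by
        rw [← Oct2.add_snd, ← map_add]
        exact congrArg (fun w => ((g : Oct2 →L[ℝ] Oct2) w).snd)
          (Oct2.ext (add_zero (0 : Oct)).symm rfl)
      map_smul' := fun r x => by
        rw [RingHom.id_apply, ← Oct2.smul_snd, ← map_smul]
        exact congrArg (fun w => ((g : Oct2 →L[ℝ] Oct2) w).snd)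
          (Oct2.ext (smul_zero r).symm rfl) }) fun x => (hf (Oct2.mk 0 x)).2
  refine ⟨g₁, g₃, GL_ext fun v => ?_⟩
  have hv : v = Oct2.mk v.fst 0 + Oct2.mk 0 v.snd := by apply Oct2.ext <;> simp
  have e1 : ((g : Oct2 →L[ℝ] Oct2) (Oct2.mk v.fst 0)).snd = 0 := by
    rw [← norm_eq_zero, (hf _).2, Oct2.mk_snd, norm_zero]
  have e2 : ((g : Oct2 →L[ℝ] Oct2) (Oct2.mk 0 v.snd)).fst = 0 := by
    rw [← norm_eq_zero, (hf _).1, Oct2.mk_fst, norm_zero]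
  rw [blockDiag_apply, h₁, h₃]
  conv_lhs => rw [hv, map_add]
  apply Oct2.ext
  · rw [Oct2.add_fst, e2, add_zero]; rfl
  · rw [Oct2.add_snd, e1, zero_add]; rfl

theorem neg_one_mem_Spin9 : (-1 : GLOct2) ∈ Spin9 := by
  have h1 : ‖Vec9.mk 1 0‖ = 1 := norm_mk_eq_one (by simp)
  have h2 : ‖-Vec9.mk 1 0‖ = 1 := by rw [norm_neg, h1]
  convert TT_mem _ _ h2 h1
  refine GL_ext fun v => ?_
  rw [TT_apply, T_neg, LinearMap.neg_apply, T_T_of_norm h1]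
  rfl

/-- An isometry that does not change the squaring map is `±1`. -/
theorem eq_one_or_eq_neg_one {g : GLOct2} (hn : ∀ v, ‖(g : Oct2 →L[ℝ] Oct2) v‖ = ‖v‖)
    (hs : ∀ v, σ ((g : Oct2 →L[ℝ] Oct2) v) = σ v) : g = 1 ∨ g = -1 := by
  obtain ⟨g₁, g₃, rfl⟩ := exists_eq_blockDiag hn fun v => by rw [hs]
  have h : ∀ a b, g₁ a * g₃ b = a * b := fun a b => by
    have := congrArg WithLp.snd (hs (Oct2.mk a b))
    exact smul_right_injective Oct (two_ne_zero' ℝ) this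
  -- From g₁(a)g₃(b) = ab one gets g₁ = right multiplication by c̄ and g₃ = left multiplication by
  -- c; then c lies in the middle nucleus and has norm 1.
  set c := g₃ 1 with hc
  have hnc : ‖c‖ = 1 := by rw [hc, LinearIsometryEquiv.norm_map, norm_one_oct]
  have hcc : (inner ℝ c c : ℝ) = 1 := by rw [inner_self_eq, hnc, one_pow]
  have h1 : ∀ a, g₁ a = a * C c := fun a => by
    have := congrArg (· * C c) (h a 1)
    simp only [mul_one] at this
    rwa [← hc, mul_mul_C, hcc, one_smul] at this
  have h3 : ∀ b, g₃ b = c * b := fun b => by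
    have := congrArg (c * ·) (h 1 b)
    simp only [h1, one_mul] at this
    rwa [mul_C_mul, hcc, one_smul] at this
  have hnuc := eq_smul_one_of_middle_nucleus (c := c) fun x y => by
    have := h (x * c) y
    rw [h1, h3, mul_mul_C, hcc, one_smul] at this
    exact this.symm
  rcases eq_or_eq_neg_of_norm_smul hnuc hnc with hc1 | hc1
  · left
    refine GL_ext fun v => ?_
    rw [blockDiag_apply, h1, h3, hc1, C_one, mul_one, one_mul]
    rfl
  · right
    refine GL_ext fun v => ?_
    rw [blockDiag_apply, h1, h3, hc1, map_neg, C_one, mul_neg, neg_mul, mul_one, one_mul]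
    rfl

/-- An even product of reflections of `O` lifts to `Spin(9)`. -/
theorem exists_lift_of_even : ∀ l : List {u : Oct // ‖u‖ = 1}, Even l.length →
    ∃ g ∈ Spin9, ∀ v, (σ ((g : Oct2 →L[ℝ] Oct2) v)).fst = (σ v).fst ∧
      (σ ((g : Oct2 →L[ℝ] Oct2) v)).snd = (l.map fun u => SU u.1).prod (σ v).snd
  | [], _ => ⟨1, one_mem _, fun v => ⟨rfl, rfl⟩⟩
  | [u], h => absurd h (by simp)
  | u :: w :: l, h => by
    obtain ⟨g, hg, H⟩ := exists_lift_of_even l (by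
      simpa [Nat.even_add_one, parity_simps] using h)
    have hu : ‖Vec9.mk 0 u.1‖ = 1 := norm_mk_eq_one (by simp [u.2])
    have hw : ‖Vec9.mk 0 w.1‖ = 1 := norm_mk_eq_one (by simp [w.2])
    refine ⟨TT _ _ hu hw * g, mul_mem (TT_mem _ _ hu hw) hg, fun v => ?_⟩
    -- On ℝ ⊕ O a half-turn about u ∈ O is -1 on ℝ and minus the reflection on O; the signs cancel
    -- in pairs.
    have key : ∀ (u : Oct) (hu : ‖u‖ = 1) (v : Oct2),
        (σ (T (Vec9.mk 0 u) v)).fst = -(σ v).fst ∧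
        (σ (T (Vec9.mk 0 u) v)).snd = -SU u (σ v).snd := fun u hu v => by
      rw [σ_T (norm_mk_eq_one (by simp [hu])), SU_apply hu, Vec9.inner_eq]
      simp
    change (σ (T (Vec9.mk 0 u.1) (T (Vec9.mk 0 w.1) (g.val v)))).fst = _ ∧
      (σ (T (Vec9.mk 0 u.1) (T (Vec9.mk 0 w.1) (g.val v)))).snd = _
    rw [(key _ u.2 _).1, (key _ u.2 _).2, (key _ w.2 _).1, (key _ w.2 _).2, (H v).1, (H v).2,
      neg_neg, map_neg, neg_neg]
    exact ⟨rfl, rfl⟩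

theorem SU_smul {r : ℝ} (hr : r ≠ 0) (v : Oct) : SU (r • v) = SU v := by
  unfold SU
  congr 2
  exact Submodule.span_singleton_smul_eq (IsUnit.mk0 r hr) v

theorem exists_unit_list (l : List Oct) : ∃ l' : List {u : Oct // ‖u‖ = 1},
    (l.map fun v => (ℝ ∙ v)ᗮ.reflection).prod = (l'.map fun u => SU u.1).prod := by
  induction l with
  | nil => exact ⟨[], rfl⟩
  | cons v l ih =>
    obtain ⟨l', h⟩ := ih
    by_cases hv : v = 0
    · refine ⟨l', ?_⟩
      rw [List.map_cons, List.prod_cons, h]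
      convert one_mul _
      ext1 x
      rw [Submodule.reflection_mem_subspace_eq_self]
      · rfl
      · rw [hv, Submodule.span_zero_singleton, Submodule.bot_orthogonal_eq_top]
        trivial
    · refine ⟨⟨(‖v‖⁻¹ : ℝ) • v, norm_smul_inv_norm hv⟩ :: l', ?_⟩
      rw [List.map_cons, List.prod_cons, h, List.map_cons, List.prod_cons,
        SU_smul (inv_ne_zero (norm_ne_zero_iff.2 hv))]
      rfl

theorem exists_even_unit_list {g : Oct ≃ₗᵢ[ℝ] Oct} (hg : IsSO8 g) :
    ∃ l : List {u : Oct // ‖u‖ = 1}, Even l.length ∧ g = (l.map fun u => SU u.1).prod := by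
  obtain ⟨l, -, hl⟩ := g.reflections_generate_dim
  obtain ⟨l', h⟩ := exists_unit_list l
  rw [h] at hl
  refine ⟨l', ?_, hl⟩
  have hdet : ∀ l : List {u : Oct // ‖u‖ = 1}, LinearMap.det
      ((l.map fun u => SU u.1).prod.toLinearEquiv : Oct →ₗ[ℝ] Oct) = (-1) ^ l.length := fun l => by
    induction l with
    | nil => exact LinearMap.det_id
    | cons u l ih =>
      rw [List.map_cons, List.prod_cons, det_mul_isometry, ih, det_SU, List.length_cons, pow_succ']
      exact norm_ne_zero_iff.1 (by rw [u.2]; exact one_ne_zero)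
  have := hdet l'
  rw [← hl, show LinearMap.det (g.toLinearEquiv : Oct →ₗ[ℝ] Oct) = 1 from hg] at this
  by_contra ho
  rw [Nat.not_even_iff_odd] at ho
  rw [ho.neg_one_pow] at this
  norm_num at this

/-- The block operator acts on `σ` by the identity on ℝ and by g₃ on O, since g₁(x)g₃(y) = g₃(xy). A
lift of the rotation g₃ to Spin(9) does the same, so the two differ by ±1, and -1 is in Spin(9). -/
theorem K1_le_Spin9 : K1 ≤ Spin9 := by
  intro g hg
  obtain ⟨g₁, g₃, h1, h, rfl⟩ := mem_K1_iff.1 hg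
  obtain ⟨l, hl, hl'⟩ := exists_even_unit_list (isSO8_of_related h1 h).2
  obtain ⟨k, hk, H⟩ := exists_lift_of_even l hl
  rw [← hl'] at H
  have hkn := (Spin9_le_SO16 (inv_mem hk)).1
  have hbn : ∀ v, ‖(blockDiag g₁ g₃ : Oct2 →L[ℝ] Oct2) v‖ = ‖v‖ := fun v => by
    refine (pow_left_inj₀ (norm_nonneg _) (norm_nonneg _) two_ne_zero).1 ?_
    rw [Oct2.norm_sq_eq, Oct2.norm_sq_eq]
    simp
  have hσ : ∀ v, σ (((k⁻¹ * blockDiag g₁ g₃ : GLOct2) : Oct2 →L[ℝ] Oct2) v) = σ v := fun v => by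
    set w := ((k⁻¹ * blockDiag g₁ g₃ : GLOct2) : Oct2 →L[ℝ] Oct2) v with hw
    have hkw : (k : Oct2 →L[ℝ] Oct2) w = (blockDiag g₁ g₃ : Oct2 →L[ℝ] Oct2) v :=
      GL_apply_inv k _
    have hH := H w
    rw [hkw] at hH
    apply Vec9.ext
    · rw [← hH.1]; simp
    · apply g₃.injective
      rw [← hH.2]; simp [h]
  have hmul : blockDiag g₁ g₃ = k * (k⁻¹ * blockDiag g₁ g₃) := by group
  rw [hmul]
  refine mul_mem hk ?_
  rcases eq_one_or_eq_neg_one (g := k⁻¹ * blockDiag g₁ g₃) (fun v => (hkn _).trans (hbn v)) hσ with h' | h'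
  · rw [h']; exact one_mem _
  · rw [h']; exact neg_one_mem_Spin9

theorem stabilizer_eq_K1 :
    Spin9 ⊓ MulAction.stabilizer GLOct2 (Oct2.mk 1 0) = K1 := by
  apply le_antisymm
  · rintro g ⟨hg, hst⟩
    have hst' : (g : Oct2 →L[ℝ] Oct2) (Oct2.mk 1 0) = Oct2.mk 1 0 := hst
    obtain ⟨ρ, hρ⟩ := exists_σ_equivariant hg
    have hσ : σ (Oct2.mk 1 0) = Vec9.mk 1 0 := by apply Vec9.ext <;> simp
    have hρe : ρ (Vec9.mk 1 0) = Vec9.mk 1 0 := by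
      have := hρ (Oct2.mk 1 0)
      rw [hst', hσ] at this
      exact this.symm
    have hin : ∀ z : Vec9, z.fst = inner ℝ (Vec9.mk 1 0) z := fun z => by
      rw [Vec9.inner_eq]; simp
    obtain ⟨g₁, g₃, rfl⟩ := exists_eq_blockDiag (Spin9_le_SO16 hg).1 fun v => by
      rw [hin, hin, hρ, ← hρe, LinearIsometryEquiv.inner_map_map, hρe]
    have h1 : g₁ 1 = 1 := congrArg Oct2.fst hst'
    refine mem_K1_iff.2 ⟨g₁, g₃, h1, fun a b => ?_, rfl⟩
    -- The vectors σ(a, b) and σ(1, ab) differ by a multiple of σ(1, 0), which ρ fixes; comparing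
    -- octonion components after applying ρ gives g₁(a)g₃(b) = g₃(ab).
    have hd : σ (Oct2.mk a b) =
        σ (Oct2.mk 1 (a * b)) + ((σ (Oct2.mk a b)).fst - (σ (Oct2.mk 1 (a * b))).fst) •
          Vec9.mk 1 0 := by
      apply Vec9.ext <;> simp
    have := congrArg ρ hd
    rw [map_add, map_smul, hρe, ← hρ, ← hρ] at this
    have := congrArg WithLp.snd this
    simp [h1] at this
    exact this.symm
  · intro g hg
    refine ⟨K1_le_Spin9 hg, ?_⟩
    obtain ⟨g₁, g₃, h1, h, rfl⟩ := mem_K1_iff.1 hg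
    change (blockDiag g₁ g₃ : Oct2 →L[ℝ] Oct2) (Oct2.mk 1 0) = _
    rw [blockDiag_apply]
    simp [h1]

/-! ### Orbits on pairs -/

theorem exists_unit_orthogonal {n : ℕ} (hn : n < 8) (f : Fin n → Oct) :
    ∃ u : Oct, ‖u‖ = 1 ∧ ∀ i, inner ℝ u (f i) = (0 : ℝ) := by
  have h1 : Module.finrank ℝ (Submodule.span ℝ (Set.range f)) ≤ n := by
    exact (finrank_range_le_card (R := ℝ) f).trans (by simp)
  have h2 := (Submodule.span ℝ (Set.range f)).finrank_add_finrank_orthogonal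
  rw [finrank_oct] at h2
  obtain ⟨u, hu, hu0⟩ := Submodule.exists_mem_ne_zero_of_ne_bot
    (p := (Submodule.span ℝ (Set.range f))ᗮ) fun h => by
      rw [h, finrank_bot] at h2
      omega
  refine ⟨(‖u‖⁻¹ : ℝ) • u, norm_smul_inv_norm hu0, fun i => ?_⟩
  rw [real_inner_smul_left, (Submodule.mem_orthogonal' _ _).1 hu _
    (Submodule.subset_span ⟨i, rfl⟩), mul_zero]

theorem blockDiag_mem_K1 (u w : ImUnit) : blockDiag (CU u * CU w) (LU u * LU w) ∈ K1 := by
  refine mem_K1_iff.2 ⟨_, _, ?_, fun a b => ?_, rfl⟩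
  · rw [LinearIsometryEquiv.coe_mul, Function.comp_apply, CU_one, CU_one]
  · simp only [LinearIsometryEquiv.coe_mul, Function.comp_apply]
    rw [LU_mul w, LU_mul u]

theorem CU_CU_eq (u w : ImUnit) (x : Oct) : CU u (CU w x) = SU u.1 (SU w.1 x) := by
  have : CU u * CU w = SU u.1 * SU w.1 := by
    rw [CU, CU, mul_assoc, ← mul_assoc (SU u.1), ← (commute_CI_SU u).eq, ← mul_assoc, ← mul_assoc,
      CI_mul_CI, one_mul]
  exact DFunLike.congr_fun this x

/-- On the first summand K₁ contains the products of two reflections in imaginary units: one takes x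
to x', the other fixes x' and corrects the parity. -/
theorem exists_K1_fst {x x' : Oct} (h1 : inner ℝ x 1 = (inner ℝ x' 1 : ℝ)) (hn : ‖x‖ = ‖x'‖) :
    ∃ k ∈ K1, ∀ y, ((k : Oct2 →L[ℝ] Oct2) (Oct2.mk x y)).fst = x' := by
  by_cases h : x = x'
  · exact ⟨1, one_mem _, fun y => h⟩
  obtain ⟨u, hu, hu'⟩ := exists_unit_orthogonal (n := 2) (by norm_num) ![1, x']
  have hu1 : inner ℝ u 1 = (0 : ℝ) := hu' 0
  have hux : inner ℝ u x' = (0 : ℝ) := hu' 1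
  have hw : SU ((‖x - x'‖⁻¹ : ℝ) • (x - x')) x = x' := by
    rw [SU_smul (inv_ne_zero (norm_ne_zero_iff.2 (sub_ne_zero.2 h)))]
    exact Submodule.reflection_sub hn
  have hw1 : inner ℝ ((‖x - x'‖⁻¹ : ℝ) • (x - x')) 1 = (0 : ℝ) := by
    rw [real_inner_smul_left, inner_sub_left, h1, sub_self, mul_zero]
  have hw2 : ‖(‖x - x'‖⁻¹ : ℝ) • (x - x')‖ = 1 := norm_smul_inv_norm (sub_ne_zero.2 h)
  refine ⟨_, blockDiag_mem_K1 ⟨u, hu1, hu⟩ ⟨_, hw1, hw2⟩, fun y => ?_⟩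
  rw [blockDiag_apply, Oct2.mk_fst, Oct2.mk_fst, LinearIsometryEquiv.coe_mul, Function.comp_apply,
    CU_CU_eq, hw, SU_apply hu, hux, mul_zero, zero_smul, sub_zero]

theorem exists_K1_snd (x : Oct) {y y' : Oct} (hn : ‖y‖ = ‖y'‖) :
    ∃ k ∈ K1, (k : Oct2 →L[ℝ] Oct2) (Oct2.mk x y) = Oct2.mk x y' := by
  by_cases hy : y = 0
  · have hy' : y' = 0 := by rw [← norm_eq_zero, ← hn, hy, norm_zero]
    exact ⟨1, one_mem _, by rw [hy, hy']; rfl⟩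
  have hny : ‖y‖ ≠ 0 := norm_ne_zero_iff.2 hy
  -- The element sought is L_u L_w with u(wy) = y', which forces w = -(uy')ȳ/|y|². Orthogonality of
  -- u to 1 and x, and of w to 1 and x, amounts by adjunction to four linear conditions on u in
  -- dimension 8.
  obtain ⟨u, hu, hu'⟩ := exists_unit_orthogonal (n := 4) (by norm_num)
    ![1, x, y * C y', (x * y) * C y']
  have hu1 : inner ℝ u 1 = (0 : ℝ) := hu' 0
  have hux : inner ℝ u x = (0 : ℝ) := hu' 1
  have hu2 : inner ℝ (u * y') y = (0 : ℝ) := by rw [inner_mul_right_C]; exact hu' 2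
  have hu3 : inner ℝ (u * y') (x * y) = (0 : ℝ) := by rw [inner_mul_right_C]; exact hu' 3
  let U : ImUnit := ⟨u, hu1, hu⟩
  let w : ImUnit := ⟨(-(‖y‖ ^ 2)⁻¹ : ℝ) • ((u * y') * C y), by
    rw [real_inner_smul_left, inner_mul_right_C, C_C, one_mul, hu2, mul_zero], by
    rw [norm_smul, norm_mul_oct, norm_mul_oct, hu, norm_C, ← hn, norm_neg, norm_inv, norm_pow,
      norm_norm]
    field_simp⟩
  have hwx : inner ℝ w.1 x = (0 : ℝ) := by
    change inner ℝ ((-(‖y‖ ^ 2)⁻¹ : ℝ) • ((u * y') * C y)) x = (0 : ℝ)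
    rw [real_inner_smul_left, inner_mul_right_C, C_C, hu3, mul_zero]
  have hwy : w.1 * y = -(u * y') := by
    change ((-(‖y‖ ^ 2)⁻¹ : ℝ) • ((u * y') * C y)) * y = _
    have := mul_mul_C (C y) (u * y')
    rw [C_C, inner_C_C, inner_self_eq] at this
    rw [smul_mul_assoc, this, smul_smul, neg_mul, inv_mul_cancel₀ (pow_ne_zero 2 hny),
      neg_one_smul]
  refine ⟨_, blockDiag_mem_K1 U w, ?_⟩
  apply Oct2.ext
  · change CU U (CU w x) = x
    rw [CU_CU_eq, SU_apply w.2.2, hwx, mul_zero, zero_smul, sub_zero, SU_apply U.2.2,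
      show inner ℝ U.1 x = (0 : ℝ) from hux, mul_zero, zero_smul, sub_zero]
  · change u * (w.1 * y) = y'
    rw [hwy, mul_neg, U.mul_mul_self y', neg_neg]

theorem exists_K1 {x x' y y' : Oct} (h1 : inner ℝ x 1 = (inner ℝ x' 1 : ℝ)) (hx : ‖x‖ = ‖x'‖)
    (hy : ‖y‖ = ‖y'‖) :
    ∃ k ∈ K1, (k : Oct2 →L[ℝ] Oct2) (Oct2.mk x y) = Oct2.mk x' y' := by
  obtain ⟨k, hk, h⟩ := exists_K1_fst h1 hx
  obtain ⟨g₁, g₃, -, -, rfl⟩ := mem_K1_iff.1 hk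
  have h' : (blockDiag g₁ g₃ : Oct2 →L[ℝ] Oct2) (Oct2.mk x y) = Oct2.mk x' (g₃ y) :=
    Oct2.ext (h y) rfl
  obtain ⟨k', hk', h''⟩ := exists_K1_snd x' (y := g₃ y) (y' := y') (by
    rw [LinearIsometryEquiv.norm_map, hy])
  refine ⟨k' * blockDiag g₁ g₃, mul_mem hk' hk, ?_⟩
  change (k' : Oct2 →L[ℝ] Oct2) ((blockDiag g₁ g₃ : Oct2 →L[ℝ] Oct2) (Oct2.mk x y)) = _
  rw [h', h'']

/-- Polarization of the invariance of the norm. -/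
theorem Spin9_inner {g : GLOct2} (hg : g ∈ Spin9) (v w : Oct2) :
    inner ℝ ((g : Oct2 →L[ℝ] Oct2) v) ((g : Oct2 →L[ℝ] Oct2) w) = (inner ℝ v w : ℝ) :=
  (LinearIsometry.mk ((g : Oct2 →L[ℝ] Oct2) : Oct2 →ₗ[ℝ] Oct2)
    (Spin9_le_SO16 hg).1).inner_map_map v w

theorem q20_eq (z : Oct2 × Oct2) : q20 z = ‖z.1‖ ^ 2 := (Oct2.norm_sq_eq z.1).symm
theorem q02_eq (z : Oct2 × Oct2) : q02 z = ‖z.2‖ ^ 2 := (Oct2.norm_sq_eq z.2).symm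
theorem q11_eq (z : Oct2 × Oct2) : q11 z = inner ℝ z.1 z.2 := (Oct2.inner_eq z.1 z.2).symm

/-- The four basic invariants of a pair. -/
def quad (z : Oct2 × Oct2) : EuclideanSpace ℝ (Fin 4) := !₂[q20 z, q11 z, q02 z, q22 z]

theorem quad_eq_iff {z w : Oct2 × Oct2} : quad w = quad z ↔
    q20 w = q20 z ∧ q11 w = q11 z ∧ q02 w = q02 z ∧ q22 w = q22 z := by
  constructor
  · intro h
    have := fun i => congrArg (fun a : EuclideanSpace ℝ (Fin 4) => a i) h
    exact ⟨this 0, this 1, this 2, this 3⟩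
  · rintro ⟨h0, h1, h2, h3⟩
    simp only [quad, h0, h1, h2, h3]

theorem quad_map {g : GLOct2} (hg : g ∈ Spin9) (z : Oct2 × Oct2) :
    quad ((g : Oct2 →L[ℝ] Oct2) z.1, (g : Oct2 →L[ℝ] Oct2) z.2) = quad z := by
  rw [quad_eq_iff]
  simp only [q20_eq, q02_eq, q11_eq, (Spin9_le_SO16 hg).1, Spin9_inner hg, true_and]
  obtain ⟨ρ, hρ⟩ := exists_σ_equivariant hg
  rw [q22, q22, hρ, hρ, LinearIsometryEquiv.inner_map_map]

theorem q22_of_eq (t : ℝ) (v : Oct2) :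
    q22 (Oct2.mk (t • 1) 0, v) = t ^ 2 * (‖v.fst‖ ^ 2 - ‖v.snd‖ ^ 2) := by
  rw [q22, Vec9.inner_eq]
  simp [norm_smul]

theorem q11_of_eq (t : ℝ) (v : Oct2) :
    q11 (Oct2.mk (t • 1) 0, v) = t * inner ℝ v.fst 1 := by
  rw [q11, real_inner_comm 1]
  simp [real_inner_smul_left]

theorem q20_of_eq (t : ℝ) (v : Oct2) : q20 (Oct2.mk (t • 1) 0, v) = t ^ 2 := by
  simp [q20, norm_smul]

theorem exists_smul_eq_of_quad_eq {z w : Oct2 × Oct2} (h : quad w = quad z) :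
    ∃ g ∈ Spin9, ((g : Oct2 →L[ℝ] Oct2) z.1, (g : Oct2 →L[ℝ] Oct2) z.2) = w := by
  have hq := quad_eq_iff.1 h
  have hn1 : ‖w.1‖ = ‖z.1‖ := (pow_left_inj₀ (norm_nonneg _) (norm_nonneg _) two_ne_zero).1 (by
    rw [← q20_eq, ← q20_eq, hq.1])
  have hn2 : ‖w.2‖ = ‖z.2‖ := (pow_left_inj₀ (norm_nonneg _) (norm_nonneg _) two_ne_zero).1 (by
    rw [← q02_eq, ← q02_eq, hq.2.2.1])
  -- When the first vector vanishes there is nothing to normalize, and transitivity on spheres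
  -- handles the second.
  by_cases hz : ‖z.1‖ = 0
  · obtain ⟨g, hg, hgz⟩ := exists_smul_eq_of_norm_eq hn2.symm
    refine ⟨g, hg, Prod.ext ?_ hgz⟩
    rw [norm_eq_zero.1 (hn1.trans hz)]
    change (g : Oct2 →L[ℝ] Oct2) z.1 = 0
    rw [norm_eq_zero.1 hz, map_zero]
  obtain ⟨a, ha, haz⟩ := exists_smul_eq_mk z.1
  obtain ⟨b, hb, hbw⟩ := exists_smul_eq_mk w.1
  rw [hn1] at hbw
  set t := ‖z.1‖ with ht
  set p := (a : Oct2 →L[ℝ] Oct2) z.2 with hp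
  set r := (b : Oct2 →L[ℝ] Oct2) w.2 with hr
  have hpr : quad (Oct2.mk (t • 1) 0, r) = quad (Oct2.mk (t • 1) 0, p) := by
    rw [← haz, hp, quad_map ha, haz, ← hbw, hr, quad_map hb, h]
  obtain ⟨-, e1, e2, e3⟩ := quad_eq_iff.1 hpr
  rw [q11_of_eq, q11_of_eq] at e1
  rw [q22_of_eq, q22_of_eq] at e3
  have e1' := mul_left_cancel₀ hz e1
  have e3' := mul_left_cancel₀ (pow_ne_zero 2 hz) e3
  simp only [q02] at e2
  -- With first vector (t, 0), t ≠ 0, the invariants give Re x, |x|² + |y|² and |x|² - |y|², hence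
  -- the data that K₁ separates.
  obtain ⟨k, hk, hkp⟩ := exists_K1 (x := p.fst) (x' := r.fst) (y := p.snd) (y' := r.snd) e1'.symm
    ((pow_left_inj₀ (norm_nonneg _) (norm_nonneg _) two_ne_zero).1 (by linarith))
    ((pow_left_inj₀ (norm_nonneg _) (norm_nonneg _) two_ne_zero).1 (by linarith))
  have hkt : (k : Oct2 →L[ℝ] Oct2) (Oct2.mk (t • 1) 0) = Oct2.mk (t • 1) 0 := by
    have hs : Oct2.mk (t • 1) 0 = t • Oct2.mk 1 0 := by apply Oct2.ext <;> simp
    have hk' := hk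
    rw [← stabilizer_eq_K1] at hk'
    rw [hs, map_smul]
    exact congrArg (t • ·) hk'.2
  refine ⟨b⁻¹ * (k * a), mul_mem (inv_mem hb) (mul_mem (K1_le_Spin9 hk) ha), Prod.ext ?_ ?_⟩
  · change ((b⁻¹ : GLOct2) : Oct2 →L[ℝ] Oct2) ((k : Oct2 →L[ℝ] Oct2) ((a : Oct2 →L[ℝ] Oct2) z.1))
      = w.1
    rw [haz, hkt, ← hbw, GL_inv_apply]
  · change ((b⁻¹ : GLOct2) : Oct2 →L[ℝ] Oct2) ((k : Oct2 →L[ℝ] Oct2) p) = w.2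
    rw [show p = Oct2.mk p.fst p.snd from rfl, hkp, show Oct2.mk r.fst r.snd = r from rfl, hr,
      GL_inv_apply]

theorem orbit_eq_quad (z : Oct2 × Oct2) : MulAction.orbit Spin9 z = {w | quad w = quad z} := by
  ext w
  constructor
  · rintro ⟨g, rfl⟩
    exact quad_map g.2 z
  · intro h
    obtain ⟨g, hg, hgz⟩ := exists_smul_eq_of_quad_eq h
    exact ⟨⟨g, hg⟩, hgz⟩

theorem orbit_eq_level_set (z : Oct2 × Oct2) : MulAction.orbit Spin9 z =
    {w | q20 w = q20 z ∧ q11 w = q11 z ∧ q02 w = q02 z ∧ q22 w = q22 z} := by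
  rw [orbit_eq_quad]
  ext w
  exact quad_eq_iff

/-! ### Polynomial functions -/

theorem linear_mem_polyFun {V : Type} [AddCommGroup V] [Module ℝ V] (l : V →ₗ[ℝ] ℝ) :
    (l : V → ℝ) ∈ polyFun V :=
  Algebra.subset_adjoin ⟨l, rfl⟩

/-- A map to a Euclidean space is polynomial if its coordinates are. -/
def IsPolyMap {V W : Type} [AddCommGroup V] [Module ℝ V] [NormedAddCommGroup W]
    [InnerProductSpace ℝ W] (F : V → W) : Prop :=
  ∀ w : W, (fun z => (inner ℝ w (F z) : ℝ)) ∈ polyFun V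

section IsPolyMap

variable {V W W' : Type} [AddCommGroup V] [Module ℝ V] [NormedAddCommGroup W]
  [InnerProductSpace ℝ W] [NormedAddCommGroup W'] [InnerProductSpace ℝ W']

theorem isPolyMap_linear (l : V →ₗ[ℝ] W) : IsPolyMap l :=
  fun w => linear_mem_polyFun ((innerₗ W w) ∘ₗ l)

theorem IsPolyMap.linear_comp [FiniteDimensional ℝ W] [FiniteDimensional ℝ W'] {F : V → W}
    (hF : IsPolyMap F) (l : W →ₗ[ℝ] W') : IsPolyMap fun z => l (F z) := fun w => by
  simpa only [LinearMap.adjoint_inner_left] using hF (l.adjoint w)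

theorem IsPolyMap.inner [FiniteDimensional ℝ W] {F G : V → W} (hF : IsPolyMap F)
    (hG : IsPolyMap G) : (fun z => (inner ℝ (F z) (G z) : ℝ)) ∈ polyFun V := by
  have h : (fun z => (Inner.inner ℝ (F z) (G z) : ℝ)) =
      ∑ i, (fun z => (Inner.inner ℝ (stdOrthonormalBasis ℝ W i) (F z) : ℝ)) *
        (fun z => (Inner.inner ℝ (stdOrthonormalBasis ℝ W i) (G z) : ℝ)) := by
    ext z
    rw [Finset.sum_apply, ← (stdOrthonormalBasis ℝ W).sum_inner_mul_inner]
    exact Finset.sum_congr rfl fun i _ => by rw [real_inner_comm]; rfl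
  rw [h]
  exact sum_mem fun i _ => mul_mem (hF _) (hG _)

/-- By adjunction ⟨w, FG⟩ = ⟨F̄w, G⟩, an inner product of two polynomial maps. -/
theorem IsPolyMap.mul {F G : V → Oct} (hF : IsPolyMap F) (hG : IsPolyMap G) :
    IsPolyMap fun z => F z * G z := fun w => by
  have h : (fun z => (Inner.inner ℝ w (F z * G z) : ℝ)) =
      fun z => (Inner.inner ℝ ((R w ∘ₗ C) (F z)) (G z) : ℝ) := by
    ext z
    rw [real_inner_comm, inner_mul_left_C, real_inner_comm]
    rfl
  rw [h]
  exact (hF.linear_comp (R w ∘ₗ C)).inner hG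

theorem IsPolyMap.norm_sq [FiniteDimensional ℝ W] {F : V → W} (hF : IsPolyMap F) :
    (fun z => ‖F z‖ ^ 2) ∈ polyFun V := by
  simpa only [real_inner_self_eq_norm_sq] using hF.inner hF

end IsPolyMap

/-- The coordinate projections of `O²`. -/
def fstₗ : Oct2 →ₗ[ℝ] Oct := ⟨⟨Oct2.fst, fun _ _ => rfl⟩, fun _ _ => rfl⟩
def sndₗ : Oct2 →ₗ[ℝ] Oct := ⟨⟨Oct2.snd, fun _ _ => rfl⟩, fun _ _ => rfl⟩

theorem q20_mem : q20 ∈ polyFun (Oct2 × Oct2) := by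
  have := (isPolyMap_linear (LinearMap.fst ℝ Oct2 Oct2)).norm_sq
  rwa [show q20 = _ from funext q20_eq]

theorem q02_mem : q02 ∈ polyFun (Oct2 × Oct2) := by
  have := (isPolyMap_linear (LinearMap.snd ℝ Oct2 Oct2)).norm_sq
  rwa [show q02 = _ from funext q02_eq]

theorem q11_mem : q11 ∈ polyFun (Oct2 × Oct2) := by
  have := (isPolyMap_linear (LinearMap.fst ℝ Oct2 Oct2)).inner
    (isPolyMap_linear (LinearMap.snd ℝ Oct2 Oct2))
  rwa [show q11 = _ from funext q11_eq]

theorem q22_eq (z : Oct2 × Oct2) : q22 z = (‖z.1.fst‖ ^ 2 - ‖z.1.snd‖ ^ 2) *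
    (‖z.2.fst‖ ^ 2 - ‖z.2.snd‖ ^ 2) +
      4 * inner ℝ (z.1.fst * z.1.snd) (z.2.fst * z.2.snd) := by
  rw [q22, Vec9.inner_eq, σ_fst, σ_fst, σ_snd, σ_snd, real_inner_smul_left, real_inner_smul_right]
  ring

theorem q22_mem : q22 ∈ polyFun (Oct2 × Oct2) := by
  have h1 := isPolyMap_linear (fstₗ ∘ₗ LinearMap.fst ℝ Oct2 Oct2)
  have h2 := isPolyMap_linear (sndₗ ∘ₗ LinearMap.fst ℝ Oct2 Oct2)
  have h3 := isPolyMap_linear (fstₗ ∘ₗ LinearMap.snd ℝ Oct2 Oct2)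
  have h4 := isPolyMap_linear (sndₗ ∘ₗ LinearMap.snd ℝ Oct2 Oct2)
  have := add_mem (mul_mem (sub_mem h1.norm_sq h2.norm_sq) (sub_mem h3.norm_sq h4.norm_sq))
    (Subalgebra.smul_mem _ ((h1.mul h2).inner (h3.mul h4)) 4)
  rwa [show q22 = _ from funext q22_eq]

theorem contDiff_of_mem_polyFun {V : Type} [NormedAddCommGroup V] [NormedSpace ℝ V]
    [FiniteDimensional ℝ V] {f : V → ℝ} (hf : f ∈ polyFun V) : ContDiff ℝ ∞ f := by
  induction hf using Algebra.adjoin_induction with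
  | mem f hf =>
    obtain ⟨l, rfl⟩ := hf
    exact l.toContinuousLinearMap.contDiff
  | algebraMap r => exact contDiff_const
  | add f g _ _ hf hg => exact hf.add hg
  | mul f g _ _ hf hg => exact hf.mul hg

/-! ### The generic orbit on pairs -/

theorem contDiff_quad : ContDiff ℝ ∞ quad := by
  rw [contDiff_euclidean]
  intro i
  fin_cases i
  · exact contDiff_of_mem_polyFun q20_mem
  · exact contDiff_of_mem_polyFun q11_mem
  · exact contDiff_of_mem_polyFun q02_mem
  · exact contDiff_of_mem_polyFun q22_mem

theorem differentiable_quad : Differentiable ℝ quad := contDiff_quad.differentiable (by simp)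

/-- Along the lines used below each invariant is at most quadratic in the parameter, so the
derivative is read off as the linear coefficient. -/
theorem fderiv_quad_apply {z w : Oct2 × Oct2} {i : Fin 4} {a b c : ℝ}
    (h : ∀ s : ℝ, quad (z + s • w) i = a + b * s + c * s ^ 2) : fderiv ℝ quad z w i = b := by
  have h1 : HasFDerivAt (fun x => quad x i)
      ((EuclideanSpace.proj i : EuclideanSpace ℝ (Fin 4) →L[ℝ] ℝ) ∘L fderiv ℝ quad z) z :=
    (EuclideanSpace.proj i : EuclideanSpace ℝ (Fin 4) →L[ℝ] ℝ).hasFDerivAt.comp z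
      (differentiable_quad z).hasFDerivAt
  have h2 : HasDerivAt (fun s : ℝ => z + s • w) w 0 := by
    simpa using ((hasDerivAt_id (0 : ℝ)).smul_const w).const_add z
  have h3 := HasFDerivAt.comp_hasDerivAt (x := (0 : ℝ)) (f := fun s : ℝ => z + s • w)
    (l := fun x => quad x i) (l' := (EuclideanSpace.proj i : EuclideanSpace ℝ (Fin 4) →L[ℝ] ℝ) ∘L
      fderiv ℝ quad z) (by simpa using h1) h2
  have h4 : HasDerivAt (fun s : ℝ => a + b * s + c * s ^ 2) b 0 :=
    ((((hasDerivAt_id (0 : ℝ)).const_mul b).const_add a).add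
      (((hasDerivAt_id (0 : ℝ)).pow 2).const_mul c)).congr_deriv (by simp)
  have h5 : (fun x => quad x i) ∘ (fun s : ℝ => z + s • w) =
      fun s : ℝ => a + b * s + c * s ^ 2 := funext h
  rw [h5] at h3
  exact h3.unique h4

/-- The polynomial that vanishes on the singular orbits. -/
def disc (z : Oct2 × Oct2) : ℝ :=
  q20 z * (q20 z * q02 z - q22 z) * (q20 z * q02 z + q22 z - 2 * q11 z ^ 2)

theorem disc_mem : disc ∈ polyFun (Oct2 × Oct2) :=
  mul_mem (mul_mem q20_mem (sub_mem (mul_mem q20_mem q02_mem) q22_mem))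
    (sub_mem (add_mem (mul_mem q20_mem q02_mem) q22_mem)
      (Subalgebra.smul_mem _ (pow_mem q11_mem 2) 2))

theorem disc_eq_of_quad_eq {z w : Oct2 × Oct2} (h : quad w = quad z) : disc w = disc z := by
  obtain ⟨h0, h1, h2, h3⟩ := quad_eq_iff.1 h
  simp only [disc, h0, h1, h2, h3]

theorem inner_one_sub_proj (x : Oct) : inner ℝ (x - (inner ℝ x 1 : ℝ) • (1 : Oct)) 1 = (0 : ℝ) := by
  rw [inner_sub_left, real_inner_smul_left, inner_self_eq, norm_one_oct]
  ring

theorem norm_sq_sub_proj (x : Oct) :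
    ‖x - (inner ℝ x 1 : ℝ) • (1 : Oct)‖ ^ 2 = ‖x‖ ^ 2 - (inner ℝ x 1) ^ 2 := by
  rw [norm_sub_sq_real, real_inner_smul_right, norm_smul, norm_one_oct, mul_one, Real.norm_eq_abs,
    sq_abs]
  ring

/-- The three factors become t², 2t²|y|² and 2t²|Im x|², so `disc` is nonzero at the normal form
exactly when t, y and Im x are. -/
theorem disc_of_eq (t : ℝ) (v : Oct2) : disc (Oct2.mk (t • 1) 0, v) =
    4 * t ^ 6 * ‖v.snd‖ ^ 2 * ‖v.fst - (inner ℝ v.fst 1 : ℝ) • (1 : Oct)‖ ^ 2 := by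
  rw [disc, q20_of_eq, q22_of_eq, q11_of_eq, norm_sq_sub_proj, q02]
  ring

theorem disc_ne_zero : disc ≠ 0 := by
  obtain ⟨u⟩ : Nonempty ImUnit := inferInstance
  intro h
  have := congrFun h (Oct2.mk ((1 : ℝ) • 1) 0, Oct2.mk u.1 1)
  rw [disc_of_eq] at this
  simp [u.2.1, u.2.2] at this

theorem quad_of_eq (t : ℝ) (x y : Oct) : quad (Oct2.mk (t • 1) 0, Oct2.mk x y) =
    !₂[t ^ 2, t * inner ℝ x 1, ‖x‖ ^ 2 + ‖y‖ ^ 2, t ^ 2 * (‖x‖ ^ 2 - ‖y‖ ^ 2)] := by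
  rw [quad, q20_of_eq, q22_of_eq, q11_of_eq, q02]
  rfl

theorem norm_add_smul_sq (x y : Oct) (s : ℝ) :
    ‖x + s • y‖ ^ 2 = ‖x‖ ^ 2 + 2 * inner ℝ x y * s + ‖y‖ ^ 2 * s ^ 2 := by
  rw [norm_add_sq_real, real_inner_smul_right, norm_smul, mul_pow, Real.norm_eq_abs, sq_abs]
  ring

theorem surjective_fderiv_quad_of_eq {t : ℝ} {v : Oct2}
    (h : disc (Oct2.mk (t • 1) 0, v) ≠ 0) :
    Function.Surjective (fderiv ℝ quad (Oct2.mk (t • 1) 0, v)) := by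
  obtain ⟨x, y, rfl⟩ : ∃ x y, v = Oct2.mk x y := ⟨v.fst, v.snd, rfl⟩
  rw [disc_of_eq] at h
  simp only [Oct2.mk_fst, Oct2.mk_snd] at h
  set r : ℝ := inner ℝ x 1 with hr
  set ξ : Oct := x - r • (1 : Oct) with hξ
  have ht : t ≠ 0 := fun h0 => h (by rw [h0]; ring)
  have hn : ‖y‖ ^ 2 ≠ 0 := fun h0 => h (by rw [h0]; ring)
  have hm : ‖ξ‖ ^ 2 ≠ 0 := fun h0 => h (by rw [h0]; ring)
  have hξ1 : inner ℝ ξ 1 = (0 : ℝ) := inner_one_sub_proj x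
  have hxξ : inner ℝ x ξ = ‖ξ‖ ^ 2 := by
    rw [norm_sq_sub_proj, hξ, inner_sub_right, real_inner_smul_right, inner_self_eq]
    ring
  set n := ‖y‖ ^ 2
  set μ := ‖ξ‖ ^ 2
  set D := fderiv ℝ quad (Oct2.mk (t • 1) 0, Oct2.mk x y) with hD
  have line : ∀ (α : ℝ) (a b : Oct) (s : ℝ),
      quad ((Oct2.mk (t • 1) 0, Oct2.mk x y) + s • (Oct2.mk (α • 1) 0, Oct2.mk a b)) =
      !₂[(t + s * α) ^ 2, (t + s * α) * (r + s * inner ℝ a 1),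
        ‖x + s • a‖ ^ 2 + ‖y + s • b‖ ^ 2,
        (t + s * α) ^ 2 * (‖x + s • a‖ ^ 2 - ‖y + s • b‖ ^ 2)] := fun α a b s => by
    rw [hr, ← real_inner_smul_left, ← inner_add_left, ← quad_of_eq]
    congr 1
    refine Prod.ext (Oct2.ext ?_ ?_) rfl
    · change t • (1 : Oct) + s • (α • (1 : Oct)) = _
      rw [smul_smul, ← add_smul]; rfl
    · change (0 : Oct) + s • (0 : Oct) = 0
      rw [smul_zero, add_zero]
  -- The four directions vary t, the real part of x, the imaginary part of x, and the length of y.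
  let w₁ : Oct2 × Oct2 := (Oct2.mk ((1 : ℝ) • 1) 0, Oct2.mk 0 0)
  let w₂ : Oct2 × Oct2 := (Oct2.mk ((0 : ℝ) • 1) 0, Oct2.mk 1 0)
  let w₃ : Oct2 × Oct2 := (Oct2.mk ((0 : ℝ) • 1) 0, Oct2.mk ξ 0)
  let w₄ : Oct2 × Oct2 := (Oct2.mk ((0 : ℝ) • 1) 0, Oct2.mk 0 y)
  have d₁ : D w₁ = !₂[2 * t, r, 0, 2 * t * (‖x‖ ^ 2 - n)] := by
    ext i
    fin_cases i
    · refine fderiv_quad_apply (a := t ^ 2) (c := 1) fun s => ?_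
      rw [line]; simp; ring
    · refine fderiv_quad_apply (a := t * r) (c := 0) fun s => ?_
      rw [line]; simp; ring
    · refine fderiv_quad_apply (a := ‖x‖ ^ 2 + n) (c := 0) fun s => ?_
      rw [line]; simp [n]
    · refine fderiv_quad_apply (a := t ^ 2 * (‖x‖ ^ 2 - n)) (c := ‖x‖ ^ 2 - n) fun s => ?_
      rw [line]; simp [n]; ring
  have d₂ : D w₂ = !₂[0, t, 2 * r, 2 * t ^ 2 * r] := by
    ext i
    fin_cases i
    · refine fderiv_quad_apply (a := t ^ 2) (c := 0) fun s => ?_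
      rw [line]; simp
    · refine fderiv_quad_apply (a := t * r) (c := 0) fun s => ?_
      rw [line]; simp; ring
    · refine fderiv_quad_apply (a := ‖x‖ ^ 2 + n) (c := 1) fun s => ?_
      rw [line]; simp [norm_add_smul_sq, n]; ring
    · refine fderiv_quad_apply (a := t ^ 2 * (‖x‖ ^ 2 - n)) (c := t ^ 2) fun s => ?_
      rw [line]; simp [norm_add_smul_sq, n]; ring
  have d₃ : D w₃ = !₂[0, 0, 2 * μ, 2 * t ^ 2 * μ] := by
    ext i
    fin_cases i
    · refine fderiv_quad_apply (a := t ^ 2) (c := 0) fun s => ?_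
      rw [line]; simp
    · refine fderiv_quad_apply (a := t * r) (c := 0) fun s => ?_
      rw [line, hξ1]; simp
    · refine fderiv_quad_apply (a := ‖x‖ ^ 2 + n) (c := μ) fun s => ?_
      rw [line]; simp [norm_add_smul_sq, hxξ, n, μ]; ring
    · refine fderiv_quad_apply (a := t ^ 2 * (‖x‖ ^ 2 - n)) (c := t ^ 2 * μ) fun s => ?_
      rw [line]; simp [norm_add_smul_sq, hxξ, n, μ]; ring
  have d₄ : D w₄ = !₂[0, 0, 2 * n, -(2 * t ^ 2 * n)] := by
    ext i
    fin_cases i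
    · refine fderiv_quad_apply (a := t ^ 2) (c := 0) fun s => ?_
      rw [line]; simp
    · refine fderiv_quad_apply (a := t * r) (c := 0) fun s => ?_
      rw [line]; simp
    · refine fderiv_quad_apply (a := ‖x‖ ^ 2 + n) (c := n) fun s => ?_
      rw [line]; simp [norm_add_smul_sq, n]; ring
    · refine fderiv_quad_apply (a := t ^ 2 * (‖x‖ ^ 2 - n)) (c := -(t ^ 2 * n)) fun s => ?_
      rw [line]; simp [norm_add_smul_sq, n]; ring
  intro p
  -- The system is triangular: the first two coordinates determine α₁ and α₂, and the last two leave
  -- an invertible 2 × 2 system in the directions `w₃`, `w₄`.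
  set α₁ := p 0 / (2 * t) with hα₁
  set α₂ := (p 1 - α₁ * r) / t with hα₂
  set r₃ := p 2 - 2 * r * α₂ with hr₃
  set r₄ := (p 3 - 2 * t * (‖x‖ ^ 2 - n) * α₁ - 2 * t ^ 2 * r * α₂) / t ^ 2 with hr₄
  refine ⟨α₁ • w₁ + α₂ • w₂ + ((r₃ + r₄) / (4 * μ)) • w₃ + ((r₃ - r₄) / (4 * n)) • w₄, ?_⟩
  simp only [map_add, map_smul, d₁, d₂, d₃, d₄]
  ext i
  fin_cases i
  · simp [hα₁]; field_simp
  · simp [hα₂]; field_simp; ring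
  · simp
    field_simp
    rw [hr₃]; ring
  · have h4 : t ^ 2 * r₄ = p 3 - 2 * t * (‖x‖ ^ 2 - n) * α₁ - 2 * t ^ 2 * r * α₂ := by
      rw [hr₄]; field_simp
    simp
    field_simp
    linear_combination 4 * h4

/-- Invariance of `quad` under g transports the rank from the normal form to z. -/
theorem surjective_fderiv_quad {z : Oct2 × Oct2} (h : disc z ≠ 0) :
    Function.Surjective (fderiv ℝ quad z) := by
  obtain ⟨g, hg, hgz⟩ := exists_smul_eq_mk z.1
  let G : Oct2 × Oct2 →L[ℝ] Oct2 × Oct2 :=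
    (g : Oct2 →L[ℝ] Oct2).prodMap (g : Oct2 →L[ℝ] Oct2)
  have hG : quad ∘ G = quad := funext fun w => quad_map hg w
  have hGz : G z = (Oct2.mk (‖z.1‖ • 1) 0, (g : Oct2 →L[ℝ] Oct2) z.2) := Prod.ext hgz rfl
  have h1 : fderiv ℝ quad z = fderiv ℝ quad (G z) ∘L G := by
    conv_lhs => rw [← hG, fderiv_comp z (differentiable_quad _) G.differentiableAt, G.fderiv]
  have h2 : Function.Surjective (fderiv ℝ quad (G z)) := by
    have hd : disc (G z) = disc z := disc_eq_of_quad_eq (congrFun hG z)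
    rw [hGz] at hd ⊢
    exact surjective_fderiv_quad_of_eq (by rwa [hd])
  rw [h1, ContinuousLinearMap.coe_comp]
  exact h2.comp fun w => ⟨(((g⁻¹ : GLOct2) : Oct2 →L[ℝ] Oct2) w.1,
    ((g⁻¹ : GLOct2) : Oct2 →L[ℝ] Oct2) w.2), Prod.ext (GL_apply_inv g _) (GL_apply_inv g _)⟩

theorem isSubmanifold_orbit {z : Oct2 × Oct2} (hz : disc z ≠ 0) :
    IsSubmanifoldOfCodim 4 (MulAction.orbit Spin9 z) := by
  intro p hp
  rw [orbit_eq_quad] at hp ⊢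
  -- The function `disc` depends only on the invariants, so it vanishes nowhere on the orbit and one
  -- open set serves for all its points.
  refine ⟨{x | disc x ≠ 0}, fun x => quad x - quad z,
    isOpen_ne_fun (contDiff_of_mem_polyFun disc_mem).continuous continuous_const, ?_,
    (contDiff_quad.sub contDiff_const).contDiffOn, fun x hx => ?_, ?_⟩
  · change disc p ≠ 0
    rwa [disc_eq_of_quad_eq hp]
  · rw [fderiv_sub_const]
    exact surjective_fderiv_quad hx
  · ext x
    simp only [Set.mem_inter_iff, Set.mem_ofPred_eq, sub_eq_zero]
    exact and_comm

/-! ### Invariant polynomials on `O²` -/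

theorem exists_polynomial_line {V : Type} [AddCommGroup V] [Module ℝ V] {f : V → ℝ}
    (hf : f ∈ polyFun V) (e : V) : ∃ p : Polynomial ℝ, ∀ t : ℝ, f (t • e) = p.eval t := by
  induction hf using Algebra.adjoin_induction with
  | mem f hf =>
    obtain ⟨l, rfl⟩ := hf
    exact ⟨Polynomial.X * Polynomial.C (l e), fun t => by simp; ring⟩
  | algebraMap r => exact ⟨Polynomial.C r, fun t => by simp⟩
  | add f g _ _ hf hg =>
    obtain ⟨p, hp⟩ := hf
    obtain ⟨p', hp'⟩ := hg
    exact ⟨p + p', fun t => by simp [hp, hp']⟩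
  | mul f g _ _ hf hg =>
    obtain ⟨p, hp⟩ := hf
    obtain ⟨p', hp'⟩ := hg
    exact ⟨p * p', fun t => by simp [hp, hp']⟩

theorem exists_even_part (p : Polynomial ℝ) :
    ∃ r : Polynomial ℝ, ∀ t : ℝ, p.eval t + p.eval (-t) = r.eval (t ^ 2) := by
  induction p using Polynomial.induction_on' with
  | add p p' hp hp' =>
    obtain ⟨r, hr⟩ := hp
    obtain ⟨r', hr'⟩ := hp'
    exact ⟨r + r', fun t => by simp only [Polynomial.eval_add, ← hr, ← hr']; ring⟩
  | monomial n a =>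
    rcases Nat.even_or_odd n with h | h
    · obtain ⟨k, hk⟩ := h
      refine ⟨Polynomial.monomial k (2 * a), fun t => ?_⟩
      simp only [Polynomial.eval_monomial, hk, ← two_mul k, pow_mul, neg_sq]
      ring
    · exact ⟨0, fun t => by simp [Polynomial.eval_monomial, h.neg_pow]⟩

theorem q_eq (v : Oct2) : q v = ‖v‖ ^ 2 := (Oct2.norm_sq_eq v).symm

theorem invPoly_eq : invPoly = Algebra.adjoin ℝ {q} := by
  apply le_antisymm
  · rintro f ⟨hf, hinv⟩
    obtain ⟨p, hp⟩ := exists_polynomial_line hf (Oct2.mk 1 0)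
    obtain ⟨r, hr⟩ := exists_even_part p
    have hs : ∀ t : ℝ, Oct2.mk (t • 1) 0 = t • Oct2.mk 1 0 := fun t => by
      apply Oct2.ext <;> simp
    -- Both (|v|, 0) and (-|v|, 0) lie in the orbit of v, so f is given by p at either sign;
    -- averaging the two leaves a polynomial in |v|².
    have key : ∀ v, f v = p.eval ‖v‖ ∧ f v = p.eval (-‖v‖) := fun v => by
      obtain ⟨g, hg, hgv⟩ := exists_smul_eq_mk v
      obtain ⟨k, hk, hkv⟩ := exists_smul_eq_of_norm_eq (v := v) (w := (-‖v‖) • Oct2.mk 1 0) (by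
        rw [neg_smul, norm_neg, ← hs, ← hgv, (Spin9_le_SO16 hg).1])
      constructor
      · rw [← hp, ← hs, ← hgv]
        exact (hinv ⟨g, hg⟩ v).symm
      · rw [← hp, ← hkv]
        exact (hinv ⟨k, hk⟩ v).symm
    have hfr : f = Polynomial.aeval q (Polynomial.C (1 / 2) * r) := by
      ext v
      have h1 : Polynomial.aeval q (Polynomial.C (1 / 2) * r) v =
          (Polynomial.C (1 / 2) * r).eval (q v) := by simp
      rw [h1, Polynomial.eval_mul, Polynomial.eval_C, q_eq, ← hr, ← (key v).1, ← (key v).2]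
      ring
    rw [hfr]
    exact Polynomial.aeval_mem_adjoin_singleton ℝ q
  · rw [Algebra.adjoin_le_iff, Set.singleton_subset_iff]
    refine ⟨?_, fun g v => ?_⟩
    · have := (isPolyMap_linear (LinearMap.id : Oct2 →ₗ[ℝ] Oct2)).norm_sq
      rwa [show q = _ from funext q_eq]
    · rw [q_eq, q_eq]
      exact congrArg (· ^ 2) ((Spin9_le_SO16 g.2).1 v)

/-! ### Scalars in a Clifford algebra -/

open CliffordAlgebra

section Scalars

variable {M : Type*} [AddCommGroup M] [Module ℝ M] {n : ℕ} (b : Module.Basis (Fin n) ℝ M)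

/-- The projection onto the elements of the exterior algebra without the basis vector `i`. -/
def basisProj (i : Fin n) :
    CliffordAlgebra (0 : QuadraticForm ℝ M) →ₗ[ℝ] CliffordAlgebra (0 : QuadraticForm ℝ M) :=
  LinearMap.id - LinearMap.mulLeft ℝ (ι (0 : QuadraticForm ℝ M) (b i)) ∘ₗ contractLeft (b.coord i)

theorem basisProj_apply (i : Fin n) (x : CliffordAlgebra (0 : QuadraticForm ℝ M)) :
    basisProj b i x = x - ι 0 (b i) * contractLeft (b.coord i) x := rfl

theorem ι_zero_mul_swap (v w : M) (x : CliffordAlgebra (0 : QuadraticForm ℝ M)) :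
    ι (0 : QuadraticForm ℝ M) v * (ι 0 w * x) = -(ι 0 w * (ι 0 v * x)) := by
  have h := ι_mul_ι_add_swap (Q := (0 : QuadraticForm ℝ M)) v w
  have hp : QuadraticMap.polar (0 : QuadraticForm ℝ M) v w = 0 := by simp [QuadraticMap.polar]
  rw [hp, map_zero] at h
  rw [← mul_assoc, eq_neg_of_add_eq_zero_left h, neg_mul, mul_assoc]

theorem basisProj_ι_mul_self (i : Fin n) (x : CliffordAlgebra (0 : QuadraticForm ℝ M)) :
    basisProj b i (ι 0 (b i) * x) = 0 := by
  rw [basisProj_apply, contractLeft_ι_mul, mul_sub, ← mul_assoc (ι 0 (b i)) (ι 0 (b i)),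
    ι_sq_scalar]
  simp

theorem basisProj_ι_mul {i j : Fin n} (h : j ≠ i)
    (x : CliffordAlgebra (0 : QuadraticForm ℝ M)) :
    basisProj b j (ι 0 (b i) * x) = ι 0 (b i) * basisProj b j x := by
  rw [basisProj_apply, basisProj_apply, contractLeft_ι_mul, mul_sub, mul_sub, ι_zero_mul_swap]
  simp [h.symm]

/-- The composition of the projections of a list of indices. -/
def basisProjList : List (Fin n) →
    CliffordAlgebra (0 : QuadraticForm ℝ M) →ₗ[ℝ] CliffordAlgebra (0 : QuadraticForm ℝ M)
  | [] => LinearMap.id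
  | i :: l => basisProjList l ∘ₗ basisProj b i

theorem basisProjList_ι_mul (l : List (Fin n)) {i : Fin n} (hi : i ∈ l)
    (x : CliffordAlgebra (0 : QuadraticForm ℝ M)) : basisProjList b l (ι 0 (b i) * x) = 0 := by
  induction l generalizing x with
  | nil => simp at hi
  | cons j l ih =>
    change basisProjList b l (basisProj b j _) = 0
    by_cases h : j = i
    · rw [h, basisProj_ι_mul_self, map_zero]
    · rw [basisProj_ι_mul b h]
      exact ih ((List.mem_cons.1 hi).resolve_left (Ne.symm h)) _

theorem basisProjList_of_contractLeft (l : List (Fin n))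
    {x : CliffordAlgebra (0 : QuadraticForm ℝ M)} (hx : ∀ i, contractLeft (b.coord i) x = 0) :
    basisProjList b l x = x := by
  induction l with
  | nil => rfl
  | cons j l ih =>
    change basisProjList b l (basisProj b j x) = x
    rw [basisProj_apply, hx, mul_zero, sub_zero, ih]

/-- The composite kills every product that starts with a basis vector, so only the scalar part
survives; elements without contractions are fixed by it. -/
theorem basisProjList_mem_scalars (x : CliffordAlgebra (0 : QuadraticForm ℝ M)) :
    ∃ r : ℝ, basisProjList b (List.finRange n) x = algebraMap ℝ _ r := by
  induction x using CliffordAlgebra.left_induction with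
  | algebraMap r =>
    exact ⟨r, basisProjList_of_contractLeft b _ fun i => contractLeft_algebraMap _ _ r⟩
  | add x y hx hy =>
    obtain ⟨r, hr⟩ := hx
    obtain ⟨s, hs⟩ := hy
    exact ⟨r + s, by rw [map_add, hr, hs, map_add]⟩
  | ι_mul x m _ =>
    refine ⟨0, ?_⟩
    rw [← b.sum_repr m, map_sum, Finset.sum_mul, map_sum, map_zero]
    refine Finset.sum_eq_zero fun i _ => ?_
    rw [map_smul, smul_mul_assoc, map_smul, basisProjList_ι_mul b _ (List.mem_finRange i),
      smul_zero]

/-- An element of a Clifford algebra all of whose contractions vanish is a scalar. -/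
theorem exists_eq_algebraMap_of_contractLeft {Q : QuadraticForm ℝ M} {x : CliffordAlgebra Q}
    (hx : ∀ i, contractLeft (b.coord i) x = 0) :
    ∃ r : ℝ, x = algebraMap ℝ (CliffordAlgebra Q) r := by
  -- Changing the form to 0 is a linear isomorphism that respects contractions and scalars, which
  -- reduces the claim to the exterior algebra.
  have hQ := changeForm.associated_neg_proof (Q := Q)
  obtain ⟨r, hr⟩ := basisProjList_mem_scalars b (changeForm hQ x)
  rw [basisProjList_of_contractLeft b _ fun i => by
    rw [← changeForm_contractLeft, hx, map_zero]] at hr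
  refine ⟨r, (changeFormEquiv hQ).injective ?_⟩
  rw [changeFormEquiv_apply, changeFormEquiv_apply, hr, changeForm_algebraMap]

/-- This turns contraction into a twisted commutator, so an even element commuting with all vectors
has no contractions. -/
theorem contractLeft_polar {Q : QuadraticForm ℝ M} (v : M) (x : CliffordAlgebra Q) :
    contractLeft (Q.polarBilin v) x = ι Q v * x - involute x * ι Q v := by
  induction x using CliffordAlgebra.left_induction with
  | algebraMap r => simp [Algebra.commutes]
  | add x y hx hy => rw [map_add, hx, hy, map_add, mul_add, add_mul]; abel
  | ι_mul x w hx =>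
    have h := congrArg (· * x) (ι_mul_ι_add_swap (Q := Q) v w)
    simp only [add_mul, mul_assoc] at h
    rw [contractLeft_ι_mul, hx, map_mul, involute_ι, Algebra.smul_def,
      QuadraticMap.polarBilin_apply_apply, ← h]
    noncomm_ring

end Scalars

/-! ### The spin representation of `Spin(7)` -/

/-- The space `ℝ⁷`. -/
abbrev Vec7 : Type := EuclideanSpace ℝ (Fin 7)

/-- An isometry of `ℝ⁷` onto the imaginary octonions. -/
def imEquiv : Vec7 ≃ₗᵢ[ℝ] (ℝ ∙ (1 : Oct))ᗮ :=
  (OrthonormalBasis.fromOrthogonalSpanSingleton 7 one_ne_zero_oct).repr.symm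

def imEmb : Vec7 →ₗᵢ[ℝ] Oct := (ℝ ∙ (1 : Oct))ᗮ.subtypeₗᵢ.comp imEquiv.toLinearIsometry

theorem inner_imEmb_one (v : Vec7) : inner ℝ (imEmb v) 1 = (0 : ℝ) := by
  rw [real_inner_comm]
  exact Submodule.mem_orthogonal_singleton_iff_inner_right.1 (imEquiv v).2

theorem exists_imEmb_eq {x : Oct} (hx : inner ℝ x 1 = (0 : ℝ)) : ∃ v, imEmb v = x := by
  rw [real_inner_comm] at hx
  refine ⟨imEquiv.symm ⟨x, Submodule.mem_orthogonal_singleton_iff_inner_right.2 hx⟩, ?_⟩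
  exact congrArg Subtype.val (imEquiv.apply_symm_apply _)

/-- Left multiplication as a linear map to the endomorphisms. -/
def Lₗ : Oct →ₗ[ℝ] Module.End ℝ Oct where
  toFun := L
  map_add' x y := LinearMap.ext fun z => add_mul x y z
  map_smul' r x := LinearMap.ext fun z => smul_mul_assoc r x z

theorem Q7_apply (v : Vec7) : Q7 v = -‖v‖ ^ 2 := by
  rw [← real_inner_self_eq_norm_sq]
  rfl

/-- The action of the Clifford algebra of `ℝ⁷` on the octonions. -/
def spinRep : CliffordAlgebra Q7 →ₐ[ℝ] Module.End ℝ Oct :=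
  CliffordAlgebra.lift Q7 ⟨Lₗ ∘ₗ imEmb.toLinearMap, fun v => by
    ext1 x
    change imEmb v * (imEmb v * x) = Q7 v • x
    have h := C_mul_mul (imEmb v) x
    rw [C_of_inner_eq_zero (inner_imEmb_one v), neg_mul, inner_self_eq, imEmb.norm_map] at h
    rw [Q7_apply, neg_smul, ← h, neg_neg]⟩

@[simp] theorem spinRep_ι (v : Vec7) (x : Oct) : spinRep (ι Q7 v) x = imEmb v * x := by
  rw [spinRep, CliffordAlgebra.lift_ι_apply]
  rfl

theorem inner_spinRep (x : CliffordAlgebra Q7) :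
    ∀ a b : Oct, inner ℝ (spinRep x a) b = (inner ℝ a (spinRep (star x) b) : ℝ) := by
  induction x using CliffordAlgebra.induction with
  | algebraMap r =>
    intro a b
    rw [CliffordAlgebra.star_algebraMap, AlgHom.commutes, Module.algebraMap_end_apply,
      Module.algebraMap_end_apply, real_inner_smul_left, real_inner_smul_right]
  | ι v =>
    intro a b
    rw [star_ι, map_neg, spinRep_ι, inner_mul_left_C, C_of_inner_eq_zero (inner_imEmb_one v),
      LinearMap.neg_apply, spinRep_ι, neg_mul]
  | mul x y hx hy =>
    intro a b
    rw [star_mul, map_mul, map_mul, Module.End.mul_apply, Module.End.mul_apply, hx, hy]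
  | add x y hx hy =>
    intro a b
    rw [star_add, map_add, map_add, LinearMap.add_apply, LinearMap.add_apply, inner_add_left,
      inner_add_right, hx, hy]

theorem norm_spinRep {x : CliffordAlgebra Q7} (hx : x ∈ Spin7) (a : Oct) :
    ‖spinRep x a‖ = ‖a‖ := by
  have h := inner_spinRep x a (spinRep x a)
  rw [← Module.End.mul_apply, ← map_mul, spinGroup.star_mul_self_of_mem hx, map_one,
    Module.End.one_apply] at h
  rw [norm_eq_sqrt_real_inner, h, ← norm_eq_sqrt_real_inner]

theorem exists_mul_ι_eq {x : CliffordAlgebra Q7} (hx : x ∈ Spin7) (v : Vec7) :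
    ∃ w, x * ι Q7 v = ι Q7 w * x := by
  let X := spinGroup.toUnits (⟨x, hx⟩ : Spin7)
  obtain ⟨w, hw⟩ := spinGroup.conjAct_smul_ι_mem_range_ι (x := X) hx v
  refine ⟨w, ?_⟩
  rw [hw, ConjAct.units_smul_def, ConjAct.ofConjAct_toConjAct]
  change x * ι Q7 v = X * ι Q7 v * ((X⁻¹ : (CliffordAlgebra Q7)ˣ) : CliffordAlgebra Q7) * X
  rw [Units.inv_mul_cancel_right]
  rfl

/-- For imaginary a this is the relation xv = wx of Spin(7) read in the representation; real a is
immediate. -/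
theorem exists_spinRep_mul {x : CliffordAlgebra Q7} (hx : x ∈ Spin7) (a : Oct) :
    ∃ a', ∀ b, spinRep x (a * b) = a' * spinRep x b := by
  have ha := inner_one_sub_proj a
  obtain ⟨v, hv⟩ := exists_imEmb_eq ha
  obtain ⟨w, hw⟩ := exists_mul_ι_eq hx v
  refine ⟨imEmb w + (inner ℝ a 1 : ℝ) • (1 : Oct), fun b => ?_⟩
  have h := LinearMap.congr_fun (congrArg spinRep hw) b
  rw [map_mul, map_mul, Module.End.mul_apply, Module.End.mul_apply, spinRep_ι, spinRep_ι, hv,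
    sub_mul, map_sub, smul_mul_assoc, one_mul, map_smul] at h
  rw [add_mul, ← h, smul_mul_assoc, one_mul, sub_add_cancel]

/-- Setting b = 1 identifies the octonion a' of `exists_spinRep_mul`: it is the image of a times the
conjugate of the image of 1, which has norm 1. -/
theorem exists_related_of_mem_Spin7 {x : CliffordAlgebra Q7} (hx : x ∈ Spin7) :
    ∃ g₁ g₃ : Oct ≃ₗᵢ[ℝ] Oct, g₁ 1 = 1 ∧ (∀ a b, g₃ (a * b) = g₁ a * g₃ b) ∧
      (∀ a, g₃ a = spinRep x a) ∧ ∀ a, g₁ a = spinRep x a * C (spinRep x 1) := by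
  have hn : ‖spinRep x 1‖ = 1 := by rw [norm_spinRep hx, norm_one_oct]
  have hi : (inner ℝ (spinRep x 1) (spinRep x 1) : ℝ) = 1 := by rw [inner_self_eq, hn, one_pow]
  obtain ⟨g₃, h₃⟩ := exists_isometry_of_norm (norm_spinRep hx)
  obtain ⟨g₁, h₁⟩ := exists_isometry_of_norm (f := R (C (spinRep x 1)) ∘ₗ spinRep x) fun a => by
    rw [LinearMap.comp_apply, R_apply, norm_mul_oct, norm_C, hn, mul_one, norm_spinRep hx]
  refine ⟨g₁, g₃, ?_, fun a b => ?_, h₃, h₁⟩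
  · rw [h₁, LinearMap.comp_apply, R_apply, mul_C_self, hi, one_smul]
  · obtain ⟨a', ha'⟩ := exists_spinRep_mul hx a
    have h := ha' 1
    rw [mul_one] at h
    rw [h₁, h₃, h₃, ha', LinearMap.comp_apply, R_apply, h, mul_mul_C, hi, one_smul]

/-- The representation is not injective on the whole algebra (dimension 128 against 64). On Spin(7),
however, xv = wx and triviality of the action force w = v, so x is even and central, hence a scalar.
-/
theorem eq_one_of_spinRep_eq_one {x : CliffordAlgebra Q7} (hx : x ∈ Spin7)
    (h : spinRep x = 1) : x = 1 := by
  have hcomm : ∀ v, ι Q7 v * x - involute x * ι Q7 v = 0 := fun v => by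
    obtain ⟨w, hw⟩ := exists_mul_ι_eq hx v
    have hvw := LinearMap.congr_fun (congrArg spinRep hw) 1
    rw [map_mul, map_mul, h, one_mul, mul_one, spinRep_ι, spinRep_ι, mul_one, mul_one] at hvw
    rw [spinGroup.involute_eq hx, hw, imEmb.injective hvw, sub_self]
  obtain ⟨r, hr⟩ := exists_eq_algebraMap_of_contractLeft
    (EuclideanSpace.basisFun (Fin 7) ℝ).toBasis (x := x) fun i => by
      -- The polar form of -|v|² is -2⟨·, ·⟩, whence the factor -1/2.
      have hd : (EuclideanSpace.basisFun (Fin 7) ℝ).toBasis.coord i =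
          (-(1 / 2) : ℝ) • Q7.polarBilin (EuclideanSpace.basisFun (Fin 7) ℝ i) := by
        ext1 v
        rw [LinearMap.smul_apply, QuadraticMap.polarBilin_apply_apply, QuadraticMap.polar,
          Q7_apply, Q7_apply, Q7_apply, norm_add_sq_real]
        simp [EuclideanSpace.inner_single_left]
        ring
      rw [hd, map_smul, LinearMap.smul_apply, contractLeft_polar, hcomm, smul_zero]
  have h1 := LinearMap.congr_fun h 1
  rw [hr, AlgHom.commutes, Module.algebraMap_end_apply, Module.End.one_apply] at h1
  have hr1 : r = 1 := by
    have : (r - 1) • (1 : Oct) = 0 := by rw [sub_smul, h1, one_smul, sub_self]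
    exact sub_eq_zero.1 ((smul_eq_zero.1 this).resolve_right one_ne_zero_oct)
  rw [hr, hr1, map_one]

theorem spinRep_injOn {x y : CliffordAlgebra Q7} (hx : x ∈ Spin7) (hy : y ∈ Spin7)
    (h : spinRep x = spinRep y) : x = y := by
  have h1 : star y * x = 1 := eq_one_of_spinRep_eq_one (mul_mem (spinGroup.star_mem hy) hx) (by
    rw [map_mul, h, ← map_mul, spinGroup.star_mul_self_of_mem hy, map_one])
  calc x = y * star y * x := by rw [spinGroup.mul_star_self_of_mem hy, one_mul]
    _ = y := by rw [mul_assoc, h1, mul_one]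

/-! ### Products of unit vectors -/

/-- The products of `n` unit vectors of `ℝ⁷` in the Clifford algebra. -/
def unitProducts : ℕ → Set (CliffordAlgebra Q7)
  | 0 => {1}
  | n + 1 => (fun p : Vec7 × CliffordAlgebra Q7 => ι Q7 p.1 * p.2) ''
      (Metric.sphere (0 : Vec7) 1 ×ˢ unitProducts n)

instance : IsModuleTopology ℝ (CliffordAlgebra Q7) := ⟨rfl⟩

/-- Expanding the vector in a basis leaves finitely many linear maps, continuous for the module
topology, with continuous coefficients. -/
theorem continuous_ι_mul :
    Continuous fun p : Vec7 × CliffordAlgebra Q7 => ι Q7 p.1 * p.2 := by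
  have : ContinuousAdd (CliffordAlgebra Q7) := IsModuleTopology.toContinuousAdd ℝ _
  have h : (fun p : Vec7 × CliffordAlgebra Q7 => ι Q7 p.1 * p.2) = fun p => ∑ i,
      p.1 i • LinearMap.mulLeft ℝ (ι Q7 (EuclideanSpace.basisFun (Fin 7) ℝ i)) p.2 := by
    ext p
    conv_lhs => rw [← (EuclideanSpace.basisFun (Fin 7) ℝ).sum_repr p.1, map_sum, Finset.sum_mul]
    exact Finset.sum_congr rfl fun i _ => by
      rw [map_smul, smul_mul_assoc, LinearMap.mulLeft_apply, EuclideanSpace.basisFun_repr]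
  rw [h]
  refine continuous_finsetSum _ fun i _ => Continuous.fun_smul ?_ ?_
  · exact (EuclideanSpace.proj (𝕜 := ℝ) i).continuous.comp continuous_fst
  · exact (IsModuleTopology.continuous_of_linearMap _).comp continuous_snd

theorem isCompact_unitProducts : ∀ n, IsCompact (unitProducts n)
  | 0 => isCompact_singleton
  | n + 1 => ((isCompact_sphere _ _).prod (isCompact_unitProducts n)).image continuous_ι_mul

theorem ι_mem_pinGroup {v : Vec7} (hv : ‖v‖ = 1) : ι Q7 v ∈ pinGroup Q7 := by
  have hsq : ι Q7 v * ι Q7 v = -1 := by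
    rw [ι_sq_scalar, Q7_apply, hv, one_pow, map_neg, map_one]
  let X : (CliffordAlgebra Q7)ˣ := ⟨ι Q7 v, -ι Q7 v, by rw [mul_neg, hsq, neg_neg], by
    rw [neg_mul, hsq, neg_neg]⟩
  refine pinGroup.mem_iff.2 ⟨⟨X, Subgroup.subset_closure ⟨v, rfl⟩, rfl⟩, ?_⟩
  rw [Unitary.mem_iff, star_ι, neg_mul, mul_neg, hsq, neg_neg]
  exact ⟨rfl, rfl⟩

theorem unitProducts_subset : ∀ (n : ℕ) {x : CliffordAlgebra Q7}, x ∈ unitProducts n →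
    x ∈ pinGroup Q7 ∧ x ∈ evenOdd Q7 (n : ZMod 2)
  | 0, x, hx => by
    rw [show x = 1 from hx]
    exact ⟨one_mem _, by simpa using SetLike.one_mem_graded (evenOdd Q7)⟩
  | n + 1, x, hx => by
    obtain ⟨⟨v, y⟩, ⟨hv, hy⟩, rfl⟩ := hx
    obtain ⟨h1, h2⟩ := unitProducts_subset n hy
    refine ⟨mul_mem (ι_mem_pinGroup (mem_sphere_zero_iff_norm.1 hv)) h1, ?_⟩
    rw [Nat.cast_add, Nat.cast_one, add_comm]
    exact SetLike.mul_mem_graded (ι_mem_evenOdd_one Q7 v) h2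

theorem unitProducts_eight_subset : unitProducts 8 ⊆ Spin7 := fun _ hx =>
  spinGroup.mem_iff.2 ⟨(unitProducts_subset 8 hx).1, (unitProducts_subset 8 hx).2⟩

theorem exists_unitProducts (l : List ImUnit) :
    ∃ x ∈ unitProducts l.length, ∀ a, spinRep x a = (l.map LU).prod a := by
  induction l with
  | nil => exact ⟨1, rfl, fun a => by rw [map_one]; rfl⟩
  | cons u l ih =>
    obtain ⟨y, hy, h⟩ := ih
    obtain ⟨v, hv⟩ := exists_imEmb_eq u.2.1
    refine ⟨ι Q7 v * y, ⟨(v, y), ⟨?_, hy⟩, rfl⟩, fun a => ?_⟩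
    · rw [mem_sphere_zero_iff_norm, ← imEmb.norm_map, hv, u.2.2]
    · rw [map_mul, Module.End.mul_apply, h, spinRep_ι, hv, List.map_cons, List.prod_cons]
      rfl

/-- An element of Spin(7) acts as some g₃, which is a product of eight imaginary units; the
corresponding eight vectors have the same image under `spinRep`, so injectivity identifies the two.
This form is what yields compactness. -/
theorem Spin7_eq : (Spin7 : Set (CliffordAlgebra Q7)) = unitProducts 8 := by
  refine Set.Subset.antisymm (fun x hx => ?_) unitProducts_eight_subset
  obtain ⟨g₁, g₃, h1, h, h₃, -⟩ := exists_related_of_mem_Spin7 hx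
  obtain ⟨l, hl, hl₃, -⟩ := exists_list_of_related h1 h
  obtain ⟨y, hy, hy'⟩ := exists_unitProducts l
  rw [hl] at hy
  rwa [spinRep_injOn hx (unitProducts_eight_subset hy) (LinearMap.ext fun a => by
    rw [hy', hl₃, h₃])]

instance : CompactSpace Spin7 := by
  have h := isCompact_unitProducts 8
  rw [← Spin7_eq] at h
  exact isCompact_iff_compactSpace.1 h

/-! ### The isomorphism -/

/-- The component g₃ determines g₁, because O has no zero divisors. -/
theorem K1_ext {g h : GLOct2} (hg : g ∈ K1) (hh : h ∈ K1)
    (H : ∀ b, ((g : Oct2 →L[ℝ] Oct2) (Oct2.mk 0 b)).snd =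
      ((h : Oct2 →L[ℝ] Oct2) (Oct2.mk 0 b)).snd) : g = h := by
  obtain ⟨g₁, g₃, -, hrel, rfl⟩ := mem_K1_iff.1 hg
  obtain ⟨k₁, k₃, -, krel, rfl⟩ := mem_K1_iff.1 hh
  have h3 : g₃ = k₃ := LinearIsometryEquiv.ext H
  have h1 : g₁ = k₁ := by
    ext1 a
    have h := (hrel a 1).symm.trans ((DFunLike.congr_fun h3 (a * 1)).trans (krel a 1))
    rw [← h3, ← sub_eq_zero, ← sub_mul] at h
    rcases mul_eq_zero_oct h with h' | h'
    · exact sub_eq_zero.1 h'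
    · exact absurd ((map_eq_zero_iff g₃ g₃.injective).1 h') one_ne_zero_oct
  rw [h3, h1]

theorem exists_mem_K1 (x : Spin7) : ∃ k : K1, ∀ v : Oct2, ((k : GLOct2) : Oct2 →L[ℝ] Oct2) v =
    Oct2.mk (spinRep x v.fst * C (spinRep x 1)) (spinRep x v.snd) := by
  obtain ⟨g₁, g₃, h1, h, h₃, h₁⟩ := exists_related_of_mem_Spin7 x.2
  refine ⟨⟨blockDiag g₁ g₃, mem_K1_iff.2 ⟨g₁, g₃, h1, h, rfl⟩⟩, fun v => ?_⟩
  rw [← h₁, ← h₃]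
  rfl

/-- The homomorphism `Spin(7) → K₁`. -/
def toK1 (x : Spin7) : K1 := (exists_mem_K1 x).choose

theorem toK1_apply (x : Spin7) (v : Oct2) : ((toK1 x : GLOct2) : Oct2 →L[ℝ] Oct2) v =
    Oct2.mk (spinRep x v.fst * C (spinRep x 1)) (spinRep x v.snd) :=
  (exists_mem_K1 x).choose_spec v

theorem toK1_mul (x y : Spin7) : toK1 (x * y) = toK1 x * toK1 y := by
  refine Subtype.ext (K1_ext (toK1 (x * y)).2 (toK1 x * toK1 y).2 fun b => ?_)
  change _ = (((toK1 x : GLOct2) : Oct2 →L[ℝ] Oct2)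
    (((toK1 y : GLOct2) : Oct2 →L[ℝ] Oct2) (Oct2.mk 0 b))).snd
  rw [toK1_apply, toK1_apply, toK1_apply]
  simp only [Oct2.mk_snd, Submonoid.coe_mul, map_mul, Module.End.mul_apply]

theorem toK1_bijective : Function.Bijective toK1 := by
  constructor
  · intro x y h
    refine Subtype.ext (spinRep_injOn x.2 y.2 (LinearMap.ext fun b => ?_))
    have := congrArg (fun k : K1 => (((k : GLOct2) : Oct2 →L[ℝ] Oct2) (Oct2.mk 0 b)).snd) h
    simpa only [toK1_apply, Oct2.mk_snd] using this
  · intro k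
    obtain ⟨g₁, g₃, h1, h, hk⟩ := mem_K1_iff.1 k.2
    obtain ⟨l, hl, hl₃, -⟩ := exists_list_of_related h1 h
    obtain ⟨y, hy, hy'⟩ := exists_unitProducts l
    rw [hl] at hy
    refine ⟨⟨y, unitProducts_eight_subset hy⟩, Subtype.ext (K1_ext (toK1 _).2 k.2 fun b => ?_)⟩
    rw [toK1_apply, hk, blockDiag_apply, ← hl₃]
    exact hy' b

theorem continuous_mul_oct : Continuous fun p : Oct × Oct => p.1 * p.2 := by
  let B := LinearMap.mkContinuous₂ Lₗ 1 fun x y => by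
    change ‖x * y‖ ≤ _
    rw [norm_mul_oct, one_mul]
  exact B.continuous₂

theorem continuous_spinRep (a : Oct) : Continuous fun x : Spin7 => spinRep x a :=
  (IsModuleTopology.continuous_of_linearMap
    (LinearMap.applyₗ a ∘ₗ spinRep.toLinearMap : CliffordAlgebra Q7 →ₗ[ℝ] Oct)).comp
    continuous_subtype_val

theorem continuous_toK1 : Continuous toK1 := by
  refine Continuous.subtype_mk (f := fun x => (toK1 x : GLOct2)) ?_ fun x => (toK1 x).2
  -- The units carry the topology induced from the operators, so continuity is tested pointwise and
  -- without the inverses.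
  rw [Units.isOpenEmbedding_val.isInducing.continuous_iff, continuous_clm_apply]
  intro v
  have h : (fun x : Spin7 => (Units.val ∘ fun x => (toK1 x : GLOct2)) x v) = fun x : Spin7 =>
      Oct2.mk (spinRep x v.fst * C (spinRep x 1)) (spinRep x v.snd) :=
    funext fun x => toK1_apply x v
  rw [h]
  have hC : Continuous C := C.continuous_of_finiteDimensional
  exact (WithLp.prod_continuous_toLp 2 Oct Oct).comp
    ((continuous_mul_oct.comp ((continuous_spinRep v.fst).prodMk
      (hC.comp (continuous_spinRep 1)))).prodMk (continuous_spinRep v.snd))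

/-- A continuous bijection from a compact space to a Hausdorff space has a continuous inverse. -/
theorem nonempty_K1_equiv_Spin7 : Nonempty (K1 ≃ₜ* Spin7) := by
  let e : Spin7 ≃* K1 := MulEquiv.ofBijective (MulHom.mk toK1 toK1_mul) toK1_bijective
  have he : Continuous e.toEquiv := continuous_toK1
  let e' : Spin7 ≃ₜ* K1 :=
    { e with
      continuous_toFun := continuous_toK1
      continuous_invFun := he.homeoOfEquivCompactToT2.continuous_symm }
  exact ⟨e'.symm⟩

end SpinNine

end

theorem mainTheorem4 :
    -- `Spin(9) ⊂ SO(16)`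
    SpinNine.Spin9 ≤ SpinNine.SO16 ∧
    -- it is transitive on the unit sphere of `O²`
    (∀ v ∈ Metric.sphere (0 : SpinNine.Oct2) 1,
      MulAction.orbit SpinNine.Spin9 v = Metric.sphere (0 : SpinNine.Oct2) 1) ∧
    -- `q` generates the algebra of invariant polynomials
    SpinNine.invPoly = Algebra.adjoin ℝ {SpinNine.q} ∧
    -- the stabilizer of `(1, 0)` is `K₁`, which is isomorphic to `Spin(7)`
    SpinNine.Spin9 ⊓ MulAction.stabilizer SpinNine.GLOct2
      (SpinNine.Oct2.mk 1 0) = SpinNine.K1 ∧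
    Nonempty (SpinNine.K1 ≃ₜ* SpinNine.Spin7) ∧
    -- the generic orbit on `O² ⊕ O²` has codimension 4
    (∃ P ∈ SpinNine.polyFun (SpinNine.Oct2 × SpinNine.Oct2), P ≠ 0 ∧
      ∀ z, P z ≠ 0 →
        SpinNine.IsSubmanifoldOfCodim 4 (MulAction.orbit SpinNine.Spin9 z)) ∧
    -- the orbits on `O² ⊕ O²` are the joint level sets
    (∀ z : SpinNine.Oct2 × SpinNine.Oct2, MulAction.orbit SpinNine.Spin9 z =
      {w | SpinNine.q20 w = SpinNine.q20 z ∧ SpinNine.q11 w = SpinNine.q11 z ∧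
        SpinNine.q02 w = SpinNine.q02 z ∧ SpinNine.q22 w = SpinNine.q22 z}) := by
  exact ⟨SpinNine.Spin9_le_SO16, SpinNine.orbit_eq_sphere, SpinNine.invPoly_eq,
    SpinNine.stabilizer_eq_K1, SpinNine.nonempty_K1_equiv_Spin7,
    ⟨SpinNine.disc, SpinNine.disc_mem, SpinNine.disc_ne_zero,
      fun _ hz => SpinNine.isSubmanifold_orbit hz⟩,
    SpinNine.orbit_eq_level_set⟩
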